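/- Let $S(\mathbb{C})$ be the space of Schwartz functions on $\mathbb{C}\cong\mathbb{R}^2$, let $dz$ be Lebesgue measure, and let $\psi(z)=e^{i\pi\Re(cz)}$ with $c\in\mathbb{C}\setminus\{0\}$ (every nontrivial continuous unitary additive character of $\mathbb{C}$ has this form; $c=1$ is the standard choice). The metaplectic double cover of $SL(2,\mathbb{C})$ splits, and the Weil representation $\omega=\omega_\psi$ of $SL(2,\mathbb{C})$ on $S(\mathbb{C})$ is given on generators by $$\omega\begin{pmatrix}1&t\\0&1\end{pmatrix}f(z)=\psi(tz^2)f(z),\qquad \omega\begin{pmatrix}\alpha&0\\0&\alpha^{-1}\end{pmatrix}f(z)=|\alpha|f(\alpha z),\qquad \omega\begin{pmatrix}0&1\\-1&0\end{pmatrix}f(z)=|c|\int_{\mathbb{C}}f(u)\psi(2zu)\,du,$$ so that for $g=\begin{pmatrix}a&b\\ \gamma&d\end{pmatrix}$ with $\gamma\neq0$ $$\omega(g)f(z)=\frac{|c|}{|\gamma|}\int_{\mathbb{C}}\psi\Big(\frac{az^2-2zu+du^2}{\gamma}\Big)f(u)\,du,$$ and $\omega(g)f(z)=|a|\,\psi(abz^2)f(az)$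 if $\gamma=0$. Let $V\subseteq S(\mathbb{C})$ be an irreducible invariant subspace of the restriction of $\omega$ to $SU(2)$, that is, a nonzero linear subspace invariant under $\omega(g)$ for all $g\in SU(2)$ whose only invariant linear subspaces closed in $V$ are $0$ and $V$. Let $f\in V$ and let $\nu$ be a continuous unitary character of $\mathbb{C}^\times$. Then the integral $$\zeta(s,\nu,f)=\int_{\mathbb{C}^\times}f(z)\nu(z)|z|^{2s-2}\,dz$$ converges absolutely for $\Re(s)>0$ and has a unique meromorphic continuation to $\mathbb{C}$, again denoted by $\zeta(s,\nu,f)$; and if $\zeta(s,\nu,f)$ is not identically zero, then all its zeros in $\mathbb{C}$ lie on the line $\Re(s)=1/2$. -/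

import Mathlib

open scoped SchwartzMap

noncomputable section

/-- The additive character `z ↦ exp(iπ Re(c z))` of `ℂ`; for `c ≠ 0` these are exactly the
nontrivial continuous unitary characters of `(ℂ, +)`. -/
def addChar (c z : ℂ) : ℂ :=
  Complex.exp (((Real.pi * (c * z).re : ℝ) : ℂ) * Complex.I)

/-- The Weil representation of `SL(2, ℂ)` (over which the metaplectic double cover splits)
attached to the additive character `addChar c`, as an action on functions `f : ℂ → ℂ`.
It is determined on generators by
* `(1 t; 0 1)` acts by `f(z) ↦ ψ(t z²) f(z)`,
* `(α 0; 0 α⁻¹)` acts by `f(z) ↦ |α| f(α z)`,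
* `(0 1; -1 0)` acts by the self-dual Fourier transform `f(z) ↦ |c| ∫ f(u) ψ(2 z u) du`,
and the formula below is the resulting one on all of `SL(2, ℂ)`. -/
def weilAction (c : ℂ) (g : Matrix.SpecialLinearGroup (Fin 2) ℂ) (f : ℂ → ℂ) (z : ℂ) : ℂ :=
  if g 1 0 = 0 then
    (‖g 0 0‖ : ℂ) * addChar c (g 0 0 * g 0 1 * z ^ 2) * f (g 0 0 * z)
  else
    ((‖c‖ / ‖g 1 0‖ : ℝ) : ℂ) *
      ∫ u : ℂ, addChar c ((g 0 0 * z ^ 2 - 2 * z * u + g 1 1 * u ^ 2) / g 1 0) * f u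

/-- A linear subspace of the Schwartz space `𝓢(ℂ)` is invariant under the restriction
of the Weil representation to `SU(2) ⊆ SL(2, ℂ)`. -/
def IsWeilInvariant (c : ℂ) (V : Submodule ℂ 𝓢(ℂ, ℂ)) : Prop :=
  ∀ g : Matrix.SpecialLinearGroup (Fin 2) ℂ,
    (g : Matrix (Fin 2) (Fin 2) ℂ) ∈ Matrix.unitaryGroup (Fin 2) ℂ →
      ∀ f ∈ V, ∃ h ∈ V, ∀ z : ℂ, h z = weilAction c g f z

/-- `V` is an irreducible invariant subspace: it is invariant, nonzero, and has no invariant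
linear subspaces closed in `V` other than `0` and `V`. Neither is `V` assumed to be closed in
`𝓢(ℂ)`, nor are subspaces that are not closed in `V` considered, so this is implied both by
algebraic irreducibility and by topological irreducibility of a closed subspace. -/
structure IsIrreducibleWeilSubspace (c : ℂ) (V : Submodule ℂ 𝓢(ℂ, ℂ)) : Prop where
  invariant : IsWeilInvariant c V
  ne_bot : V ≠ ⊥
  irreducible : ∀ U : Submodule ℂ 𝓢(ℂ, ℂ), U ≤ V → IsWeilInvariant c U →
    IsClosed {v : V | (v : 𝓢(ℂ, ℂ)) ∈ U} → U = ⊥ ∨ U = V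

/-- A (unitary) character of `ℂˣ`, extended by `0` to `ℂ`. -/
def mulCharExt (ν : ℂˣ →ₜ* Circle) (z : ℂ) : ℂ :=
  if h : z = 0 then 0 else (ν (Units.mk0 z h) : ℂ)

/-- The integrand `f(z) ν(z) |z|^(2s-2)` of the local Tate zeta function. -/
def tateIntegrand (ν : ℂˣ →ₜ* Circle) (f : 𝓢(ℂ, ℂ)) (s z : ℂ) : ℂ :=
  f z * mulCharExt ν z * (‖z‖ : ℂ) ^ (2 * s - 2)

/-- `Z` is the local Tate zeta function `s ↦ ζ(s, ν, f)`: the meromorphic function on `ℂ`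
which is given for `Re s > 0` by the integral of `f(z) ν(z) |z|^(2s-2)` over `ℂ \ {0}`. The normal
form requirement fixes the values of `Z` also at removable singularities (by continuity)
and at poles (value `0`). -/
structure IsTateZeta (ν : ℂˣ →ₜ* Circle) (f : 𝓢(ℂ, ℂ)) (Z : ℂ → ℂ) : Prop where
  meromorphic : MeromorphicNFOn Z Set.univ
  eq_integral : ∀ s : ℂ, 0 < s.re → Z s = ∫ z in ({0}ᶜ : Set ℂ), tateIntegrand ν f s z

end

open MeasureTheory ComplexConjugate Finset.HasAntidiagonal

namespace WeilSU2

noncomputable section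

/-! ### Gaussian integrals on `ℂ` -/

/-! Put `A = π‖c‖`. The Bargmann transform with Gaussian weight `exp(-A|z|²)` sends functions on `ℂ`
to entire functions of `(l, m)`. It is injective (`eq_zero_of_bargmann_eq_zero`) and turns the
action of `SU(2)` into a linear substitution in `(l, m)` (`bargmann_weilAction`). The homogeneous
Taylor components are therefore equivariant. On an irreducible `V` each is either injective or zero,
and comparing highest weights shows that only one degree `n` survives (`exists_degree`). Inverting
the transform, every `f ∈ V` is a combination of complex Hermite functions `H_{k,j}` with `k + j =
n` (`exists_hermite_expansion`).

Under rotations `H_{k,j}` has weight `k - j`, so integrating against `ν` in polar coordinates leaves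
at most one `H_{k,j}`. With `a = |k - j|` and `l = min(k, j)`, its radial Mellin transform is, up to
constants and an exponential, `Γ(s + a/2)` times a polynomial `p_l(s)`, with `s` shifted by an
imaginary constant (`hermiteMellin_eq_Gamma_mul`). These polynomials satisfy `p_{l+2} = (s - 1/2)
p_{l+1} + (l+1)(l+1+a)/4 · p_l`. The last coefficient is positive, so for `Re s ≠ 1/2` the ratio
`p_{l+1}/p_l` stays in the open half plane containing `s - 1/2`, and no `p_l` vanishes there
(`mellinPoly_ratio`). Since `1/Γ` is entire, the zeros of the zeta function are among those of the
polynomial factor. -/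

theorem integral_cexp_quadratic_complex_diag {A : ℝ} (hA : 0 < A) (b : ℝ) (p r : ℂ) :
    ∫ z : ℂ, Complex.exp (-(A : ℂ) * (‖z‖ : ℂ) ^ 2
        + Complex.I * (b * z ^ 2 + b * (conj z) ^ 2) + p * z + r * conj z)
      = (Real.pi / Real.sqrt (A ^ 2 + 4 * b ^ 2) : ℝ) *
        Complex.exp ((A * p * r + Complex.I * (b * p ^ 2 + b * r ^ 2))
          / ((A ^ 2 + 4 * b ^ 2 : ℝ) : ℂ)) := by
  have hre1 : (-(A : ℂ) + 2 * b * Complex.I).re < 0 := by simp [hA]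
  have hre2 : (-(A : ℂ) - 2 * b * Complex.I).re < 0 := by simp [hA]
  have hsplit : ∀ q : ℝ × ℝ, Complex.exp (-(A : ℂ) * (‖Complex.measurableEquivRealProd.symm q‖ : ℂ) ^ 2
        + Complex.I * (b * (Complex.measurableEquivRealProd.symm q) ^ 2
          + b * (conj (Complex.measurableEquivRealProd.symm q)) ^ 2)
          + p * (Complex.measurableEquivRealProd.symm q)
          + r * conj (Complex.measurableEquivRealProd.symm q))
      = Complex.exp ((-(A : ℂ) + 2 * b * Complex.I) * (q.1 : ℂ) ^ 2 + (p + r) * q.1 + 0) *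
        Complex.exp ((-(A : ℂ) - 2 * b * Complex.I) * (q.2 : ℂ) ^ 2
          + Complex.I * (p - r) * q.2 + 0) := by
    intro q
    have h1 : Complex.measurableEquivRealProd.symm q = (q.1 : ℂ) + q.2 * Complex.I := by
      apply Complex.ext <;> simp [Complex.measurableEquivRealProd_symm_apply]
    have h2 : (‖(q.1 : ℂ) + q.2 * Complex.I‖ : ℂ) ^ 2 = (q.1 : ℂ) ^ 2 + (q.2 : ℂ) ^ 2 := by
      rw [← Complex.mul_conj']
      simp only [map_add, map_mul, Complex.conj_ofReal, Complex.conj_I]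
      ring_nf
      rw [Complex.I_sq]; ring
    rw [h1, h2, ← Complex.exp_add]
    congr 1
    simp only [map_add, map_mul, Complex.conj_ofReal, Complex.conj_I]
    ring_nf
    simp only [Complex.I_pow_three]
    ring
  rw [← (Complex.volume_preserving_equiv_real_prod.symm).integral_comp
    Complex.measurableEquivRealProd.symm.measurableEmbedding]
  simp_rw [hsplit]
  rw [Measure.volume_eq_prod, integral_prod_mul
    (fun x : ℝ => Complex.exp ((-(A : ℂ) + 2 * b * Complex.I) * (x : ℂ) ^ 2 + (p + r) * x + 0))
    (fun x : ℝ => Complex.exp ((-(A : ℂ) - 2 * b * Complex.I) * (x : ℂ) ^ 2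
      + Complex.I * (p - r) * x + 0)), integral_cexp_quadratic hre1,
    integral_cexp_quadratic hre2]
  have hD : (0 : ℝ) < A ^ 2 + 4 * b ^ 2 := by positivity
  have hconj : (Real.pi / -(-(A : ℂ) - 2 * b * Complex.I))
      = conj (Real.pi / -(-(A : ℂ) + 2 * b * Complex.I)) := by
    simp [Complex.conj_ofReal, map_ofNat]
  have hw : 0 < (Real.pi / -(-(A : ℂ) + 2 * b * Complex.I)).re := by
    rw [Complex.div_re]
    simp only [Complex.ofReal_re, Complex.ofReal_im, zero_mul, zero_div, add_zero]
    have : 0 < (-(-(A : ℂ) + 2 * b * Complex.I)).re := by simp [hA]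
    have h0 : -(-(A : ℂ) + 2 * b * Complex.I) ≠ 0 := fun h => by rw [h] at this; simp at this
    have := Complex.normSq_pos.2 h0
    positivity
  have hnorm : ‖(Real.pi / -(-(A : ℂ) + 2 * b * Complex.I))‖
      = Real.pi / Real.sqrt (A ^ 2 + 4 * b ^ 2) := by
    rw [norm_div, norm_neg, Complex.norm_of_nonneg Real.pi_pos.le, Complex.norm_def]
    congr 2
    simp [Complex.normSq_apply]; ring
  -- The two one-dimensional prefactors are principal square roots of conjugate numbers with
  -- positive real part, so their product is a modulus and no branch ambiguity arises.
  have hprod : (Real.pi / -(-(A : ℂ) + 2 * b * Complex.I)) ^ (1 / 2 : ℂ)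
      * (Real.pi / -(-(A : ℂ) - 2 * b * Complex.I)) ^ (1 / 2 : ℂ)
      = (Real.pi / Real.sqrt (A ^ 2 + 4 * b ^ 2) : ℝ) := by
    rw [hconj, ← hnorm]
    set w := (Real.pi / -(-(A : ℂ) + 2 * b * Complex.I)) with hwdef
    have harg : w.arg ≠ Real.pi := fun h => by
      rw [Complex.arg_eq_pi_iff] at h; linarith [h.1]
    have h12 : (1 / 2 : ℂ) = conj (1 / 2 : ℂ) := by simp [map_ofNat]
    rw [Complex.conj_cpow _ _ harg, ← h12, Complex.mul_conj', ← Complex.ofReal_pow]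
    congr 1
    have : (1 / 2 : ℂ) = ((1 / 2 : ℝ) : ℂ) := by simp
    rw [this, Complex.norm_cpow_real, ← Real.rpow_natCast, ← Real.rpow_mul (norm_nonneg _)]
    norm_num
  rw [mul_mul_mul_comm, hprod, ← Complex.exp_add]
  congr 2
  have e1 : (-(A : ℂ) + 2 * b * Complex.I) ≠ 0 := fun h => by rw [h] at hre1; simp at hre1
  have e2 : (-(A : ℂ) - 2 * b * Complex.I) ≠ 0 := fun h => by rw [h] at hre2; simp at hre2
  have e3 : ((A ^ 2 + 4 * b ^ 2 : ℝ) : ℂ)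
      = (-(A : ℂ) + 2 * b * Complex.I) * (-(A : ℂ) - 2 * b * Complex.I) := by
    push_cast
    ring_nf
    simp only [Complex.I_sq]
    ring
  rw [e3]
  field_simp
  ring_nf
  simp only [Complex.I_sq, Complex.I_pow_three]
  ring

/-- A rotation by minus half the argument of `β` preserves Lebesgue measure and makes `β` real and
nonnegative, which reduces the integral to the diagonal case. -/
theorem integral_cexp_quadratic_complex {A : ℝ} (hA : 0 < A) (β p r : ℂ) :
    ∫ z : ℂ, Complex.exp (-(A : ℂ) * (‖z‖ : ℂ) ^ 2
        + Complex.I * (β * z ^ 2 + conj β * (conj z) ^ 2) + p * z + r * conj z)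
      = (Real.pi / Real.sqrt (A ^ 2 + 4 * ‖β‖ ^ 2) : ℝ) *
        Complex.exp ((A * p * r + Complex.I * (conj β * p ^ 2 + β * r ^ 2))
          / ((A ^ 2 + 4 * ‖β‖ ^ 2 : ℝ) : ℂ)) := by
  obtain ⟨u, hu⟩ : ∃ u : Circle, β * (u : ℂ) ^ 2 = ‖β‖ := by
    refine ⟨Circle.exp (-(β.arg / 2)), ?_⟩
    conv_lhs => enter [1]; rw [← Complex.norm_mul_exp_arg_mul_I β]
    rw [Circle.coe_exp, ← Complex.exp_nat_mul, mul_assoc, ← Complex.exp_add]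
    have : (β.arg : ℂ) * Complex.I + ((2 : ℕ) : ℂ) * (((-(β.arg / 2) : ℝ) : ℂ) * Complex.I) = 0 := by
      push_cast; ring
    rw [this, Complex.exp_zero, mul_one]
  have huu : (u : ℂ) * conj (u : ℂ) = 1 := by rw [Complex.mul_conj', Circle.norm_coe]; simp
  have hu2 : conj β * (conj (u : ℂ)) ^ 2 = ‖β‖ := by
    rw [← map_pow, ← map_mul, hu, Complex.conj_ofReal]
  rw [← ((rotation u).measurePreserving).integral_comp
    (rotation u).toHomeomorph.measurableEmbedding]
  have key := integral_cexp_quadratic_complex_diag hA ‖β‖ (p * u) (r * conj (u : ℂ))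
  have e : ∀ z : ℂ, Complex.exp (-(A : ℂ) * (‖rotation u z‖ : ℂ) ^ 2
        + Complex.I * (β * (rotation u z) ^ 2 + conj β * (conj (rotation u z)) ^ 2)
          + p * (rotation u z) + r * conj (rotation u z)) =
      Complex.exp (-(A : ℂ) * (‖z‖ : ℂ) ^ 2
        + Complex.I * (‖β‖ * z ^ 2 + ‖β‖ * (conj z) ^ 2) + p * u * z
          + r * conj (u : ℂ) * conj z) := by
    intro z
    congr 1
    rw [LinearIsometryEquiv.norm_map, rotation_apply, map_mul]
    linear_combination Complex.I * z ^ 2 * hu + Complex.I * (conj z) ^ 2 * hu2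
  simp_rw [e]
  rw [key]
  congr 3
  have h3 : (‖β‖ : ℂ) * (u : ℂ) ^ 2 * (conj (u : ℂ)) ^ 2 = ‖β‖ := by
    linear_combination ‖β‖ * ((u : ℂ) * conj (u : ℂ) + 1) * huu
  have h1 : (‖β‖ : ℂ) * (u : ℂ) ^ 2 = conj β := by
    rw [← hu2]; linear_combination conj β * ((u : ℂ) * conj (u : ℂ) + 1) * huu
  have h2 : (‖β‖ : ℂ) * (conj (u : ℂ)) ^ 2 = β := by
    rw [← hu]; linear_combination β * ((u : ℂ) * conj (u : ℂ) + 1) * huu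
  linear_combination A * p * r * huu + Complex.I * p ^ 2 * h1 + Complex.I * r ^ 2 * h2

theorem integrable_exp_neg_mul_sq_norm_add {A : ℝ} (hA : 0 < A) (R : ℝ) :
    Integrable fun z : ℂ => Real.exp (-A * ‖z‖ ^ 2 + R * ‖z‖) := by
  have h := (GaussianFourier.integrable_cexp_neg_mul_sq_norm_add (V := ℂ) (b := ((A / 2 : ℝ) : ℂ))
    (by simpa using hA) 0 0).norm.const_mul (Real.exp (R ^ 2 / (2 * A)))
  refine h.mono' (by fun_prop) (Filter.Eventually.of_forall fun z => ?_)
  rw [Real.norm_of_nonneg (Real.exp_pos _).le, Complex.norm_exp, ← Real.exp_add]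
  apply Real.exp_le_exp.2
  have : (-((A / 2 : ℝ) : ℂ) * (‖z‖ : ℂ) ^ 2 + 0 * ((inner ℝ (0 : ℂ) z : ℝ) : ℂ)).re
      = - (A / 2) * ‖z‖ ^ 2 := by
    rw [← Complex.ofReal_pow, ← Complex.ofReal_neg, ← Complex.ofReal_mul, zero_mul, add_zero, Complex.ofReal_re]
  rw [this]
  have h3 : R ^ 2 / (2 * A) - (R * ‖z‖ - A / 2 * ‖z‖ ^ 2) = (R - A * ‖z‖) ^ 2 / (2 * A) := by
    field_simp; ring
  have : 0 ≤ (R - A * ‖z‖) ^ 2 / (2 * A) := by positivity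
  linarith

/-! ### The Bargmann transform -/

/-- Continuous functions on `ℂ` whose product with `exp (-A |z|² + R |z|)` is integrable
for all `R`. -/
structure GaussTame (A : ℝ) (f : ℂ → ℂ) : Prop where
  continuous : Continuous f
  integrable : ∀ R : ℝ, Integrable fun z : ℂ => ‖f z‖ * Real.exp (-A * ‖z‖ ^ 2 + R * ‖z‖)

namespace GaussTame

variable {A : ℝ} {f g : ℂ → ℂ}

theorem of_bounded (hA : 0 < A) (hf : Continuous f) {C : ℝ} (hC : ∀ z, ‖f z‖ ≤ C) :
    GaussTame A f := by
  refine ⟨hf, fun R => ((integrable_exp_neg_mul_sq_norm_add hA R).const_mul C).mono'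
    (by fun_prop) (Filter.Eventually.of_forall fun z => ?_)⟩
  rw [norm_mul, norm_norm, Real.norm_of_nonneg (Real.exp_pos _).le]
  exact mul_le_mul_of_nonneg_right (hC z) (Real.exp_pos _).le

/-- A factor `‖z‖` is absorbed by `exp ‖z‖` at the cost of raising `R` by one. Quantifying over all
`R` in `GaussTame` is what makes the class stable under multiplication by `z` and `conj z`. -/
theorem of_norm_le_mul (hf : GaussTame A f) (hg : Continuous g)
    (h : ∀ z, ‖g z‖ ≤ ‖z‖ * ‖f z‖) : GaussTame A g := by
  have := hf.continuous
  refine ⟨hg, fun R => (hf.integrable (R + 1)).mono' (by fun_prop)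
    (Filter.Eventually.of_forall fun z => ?_)⟩
  rw [norm_mul, norm_norm, Real.norm_of_nonneg (Real.exp_pos _).le]
  have h1 : ‖z‖ ≤ Real.exp ‖z‖ := by linarith [Real.add_one_le_exp ‖z‖]
  have h2 : -A * ‖z‖ ^ 2 + (R + 1) * ‖z‖ = ‖z‖ + (-A * ‖z‖ ^ 2 + R * ‖z‖) := by ring
  rw [h2, Real.exp_add ‖z‖, ← mul_assoc]
  refine mul_le_mul_of_nonneg_right ((h z).trans ?_) (Real.exp_pos _).le
  rw [mul_comm]
  exact mul_le_mul_of_nonneg_left h1 (norm_nonneg _)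

theorem id_mul (hf : GaussTame A f) : GaussTame A fun z => z * f z :=
  hf.of_norm_le_mul (continuous_id.mul hf.continuous) fun _ => (norm_mul _ _).le

theorem conj_mul (hf : GaussTame A f) : GaussTame A fun z => conj z * f z :=
  hf.of_norm_le_mul (Complex.continuous_conj.mul hf.continuous) fun z => by simp

theorem const_mul (hf : GaussTame A f) (a : ℂ) : GaussTame A fun z => a * f z := by
  refine ⟨continuous_const.mul hf.continuous, fun R => ?_⟩
  simpa [mul_assoc] using (hf.integrable R).const_mul ‖a‖

theorem sub (hf : GaussTame A f) (hg : GaussTame A g) : GaussTame A fun z => f z - g z := by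
  have := hf.continuous
  have := hg.continuous
  refine ⟨by fun_prop, fun R => ((hf.integrable R).add (hg.integrable R)).mono' (by fun_prop)
    (Filter.Eventually.of_forall fun z => ?_)⟩
  rw [norm_mul, norm_norm, Real.norm_of_nonneg (Real.exp_pos _).le]
  simp only [Pi.add_apply, ← add_mul]
  exact mul_le_mul_of_nonneg_right (norm_sub_le _ _) (Real.exp_pos _).le

theorem zero : GaussTame A fun _ => 0 := ⟨continuous_const, fun R => by simp⟩

theorem add (hf : GaussTame A f) (hg : GaussTame A g) : GaussTame A fun z => f z + g z := by
  simpa using hf.sub (hg.const_mul (-1))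

theorem sum {ι : Type*} (s : Finset ι) {F : ι → ℂ → ℂ} (h : ∀ i ∈ s, GaussTame A (F i)) :
    GaussTame A fun z => ∑ i ∈ s, F i z := by
  classical
  induction s using Finset.induction_on with
  | empty => simpa using zero
  | insert i s hi ih =>
    simp only [Finset.sum_insert hi]
    exact (h i (by simp)).add (ih fun j hj => h j (by simp [hj]))

end GaussTame

theorem norm_cexp_gauss_le (A : ℝ) (l m z : ℂ) {R : ℝ} (hR : ‖l‖ + ‖m‖ ≤ R) :
    ‖Complex.exp (-(A : ℂ) * (‖z‖ : ℂ) ^ 2 + l * z + m * conj z)‖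
      ≤ Real.exp (-A * ‖z‖ ^ 2 + R * ‖z‖) := by
  rw [Complex.norm_exp]
  apply Real.exp_le_exp.2
  have h1 : (-(A : ℂ) * (‖z‖ : ℂ) ^ 2).re = -A * ‖z‖ ^ 2 := by
    rw [← Complex.ofReal_pow, ← Complex.ofReal_neg, ← Complex.ofReal_mul, Complex.ofReal_re]
  have h2 : (l * z).re ≤ ‖l‖ * ‖z‖ := (Complex.re_le_norm _).trans (norm_mul _ _).le
  have h3 : (m * conj z).re ≤ ‖m‖ * ‖z‖ := (Complex.re_le_norm _).trans (by simp)
  rw [Complex.add_re, Complex.add_re, h1]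
  nlinarith [mul_le_mul_of_nonneg_right hR (norm_nonneg z)]

theorem GaussTame.integrable_mul_cexp {A : ℝ} {f : ℂ → ℂ} (hf : GaussTame A f) (l m : ℂ) :
    Integrable fun z : ℂ =>
      f z * Complex.exp (-(A : ℂ) * (‖z‖ : ℂ) ^ 2 + l * z + m * conj z) := by
  have := hf.continuous
  refine (hf.integrable (‖l‖ + ‖m‖)).mono' (by fun_prop) (Filter.Eventually.of_forall fun z => ?_)
  rw [norm_mul]
  exact mul_le_mul_of_nonneg_left (norm_cexp_gauss_le A l m z le_rfl) (norm_nonneg _)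

/-- The Laplace transform of `f` in the variables `z` and `conj z`, with a Gaussian weight. -/
def gaussLaplace (A : ℝ) (f : ℂ → ℂ) (l m : ℂ) : ℂ :=
  ∫ z : ℂ, f z * Complex.exp (-(A : ℂ) * (‖z‖ : ℂ) ^ 2 + l * z + m * conj z)

/-- The Bargmann transform of `f`, an entire function on `ℂ²`. -/
def bargmann (A : ℝ) (f : ℂ → ℂ) (l m : ℂ) : ℂ :=
  Complex.exp (-(l * m) / (2 * A)) * gaussLaplace A f l m

/-- Differentiation under the integral sign brings down `l₁ z + m₁ conj z`. Working along an
arbitrary complex line covers both the partial derivatives and the derivative along rays through the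
origin. -/
theorem hasDerivAt_gaussLaplace {A : ℝ} {f : ℂ → ℂ} (hf : GaussTame A f) (l₀ m₀ l₁ m₁ t : ℂ) :
    HasDerivAt (fun t => gaussLaplace A f (l₀ + t * l₁) (m₀ + t * m₁))
      (l₁ * gaussLaplace A (fun z => z * f z) (l₀ + t * l₁) (m₀ + t * m₁)
        + m₁ * gaussLaplace A (fun z => conj z * f z) (l₀ + t * l₁) (m₀ + t * m₁)) t := by
  have hc := hf.continuous
  -- This bounds `‖l₀ + s l₁‖ + ‖m₀ + s m₁‖` for every `s` in the unit ball around `t`, giving one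
  -- dominating function.
  set R := ‖l₀‖ + ‖m₀‖ + (‖t‖ + 1) * (‖l₁‖ + ‖m₁‖) with hR
  have hg : GaussTame A fun z => l₁ * (z * f z) + m₁ * (conj z * f z) :=
    (hf.id_mul.const_mul l₁).add (hf.conj_mul.const_mul m₁)
  have key := hasDerivAt_integral_of_dominated_loc_of_deriv_le (μ := (volume : Measure ℂ))
    (F := fun t z => f z * Complex.exp (-(A : ℂ) * (‖z‖ : ℂ) ^ 2 + (l₀ + t * l₁) * z
      + (m₀ + t * m₁) * conj z))
    (F' := fun t z => (l₁ * (z * f z) + m₁ * (conj z * f z)) *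
      Complex.exp (-(A : ℂ) * (‖z‖ : ℂ) ^ 2 + (l₀ + t * l₁) * z + (m₀ + t * m₁) * conj z))
    (x₀ := t) (Metric.ball_mem_nhds t one_pos)
    (bound := fun z => ‖l₁ * (z * f z) + m₁ * (conj z * f z)‖ *
      Real.exp (-A * ‖z‖ ^ 2 + R * ‖z‖))
    (Filter.Eventually.of_forall fun s => (hf.integrable_mul_cexp _ _).aestronglyMeasurable)
    (hf.integrable_mul_cexp _ _) (hg.integrable_mul_cexp _ _).aestronglyMeasurable
    (Filter.Eventually.of_forall fun z s hs => ?_) (hg.integrable R)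
    (Filter.Eventually.of_forall fun z s _ => ?_)
  · refine key.2.congr_deriv ?_
    unfold gaussLaplace
    rw [← integral_const_mul, ← integral_const_mul, ← integral_add
      ((hf.id_mul.integrable_mul_cexp _ _).const_mul _)
      ((hf.conj_mul.integrable_mul_cexp _ _).const_mul _)]
    congr 1
    ext z
    ring
  · rw [norm_mul]
    refine mul_le_mul_of_nonneg_left (norm_cexp_gauss_le A _ _ z ?_) (norm_nonneg _)
    have hs' : ‖s‖ ≤ ‖t‖ + 1 := by
      have h1 : ‖s - t‖ < 1 := by simpa [dist_eq_norm] using hs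
      have h2 := norm_add_le t (s - t)
      rw [add_sub_cancel] at h2
      linarith
    have h1 := norm_add_le l₀ (s * l₁)
    have h2 := norm_add_le m₀ (s * m₁)
    rw [norm_mul] at h1 h2
    nlinarith [mul_le_mul_of_nonneg_right hs' (norm_nonneg l₁),
      mul_le_mul_of_nonneg_right hs' (norm_nonneg m₁)]
  · have h : HasDerivAt (fun s => -(A : ℂ) * (‖z‖ : ℂ) ^ 2 + (l₀ + s * l₁) * z
        + (m₀ + s * m₁) * conj z) (l₁ * z + m₁ * conj z) s := by
      have h1 := (((hasDerivAt_id s).mul_const l₁).const_add l₀).mul_const z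
      have h2 := (((hasDerivAt_id s).mul_const m₁).const_add m₀).mul_const (conj z)
      simpa only [one_mul, id_eq] using (h1.const_add (-(A : ℂ) * (‖z‖ : ℂ) ^ 2)).fun_add h2
    refine (h.cexp.const_mul (f z)).congr_deriv ?_
    ring

theorem gaussLaplace_sub {A : ℝ} {f g : ℂ → ℂ} (hf : GaussTame A f) (hg : GaussTame A g)
    (l m : ℂ) : gaussLaplace A (fun z => f z - g z) l m
      = gaussLaplace A f l m - gaussLaplace A g l m := by
  simp only [gaussLaplace, sub_mul]
  exact integral_sub (hf.integrable_mul_cexp l m) (hg.integrable_mul_cexp l m)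

theorem gaussLaplace_const_mul {A : ℝ} {f : ℂ → ℂ} (a l m : ℂ) :
    gaussLaplace A (fun z => a * f z) l m = a * gaussLaplace A f l m := by
  simp only [gaussLaplace, mul_assoc]
  exact integral_const_mul _ _

theorem bargmann_sub {A : ℝ} {f g : ℂ → ℂ} (hf : GaussTame A f) (hg : GaussTame A g) (l m : ℂ) :
    bargmann A (fun z => f z - g z) l m = bargmann A f l m - bargmann A g l m := by
  rw [bargmann, gaussLaplace_sub hf hg, mul_sub]; rfl

theorem bargmann_const_mul {A : ℝ} {f : ℂ → ℂ} (a l m : ℂ) :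
    bargmann A (fun z => a * f z) l m = a * bargmann A f l m := by
  rw [bargmann, gaussLaplace_const_mul, bargmann]; ring

theorem bargmann_add {A : ℝ} {f g : ℂ → ℂ} (hf : GaussTame A f) (hg : GaussTame A g) (l m : ℂ) :
    bargmann A (fun z => f z + g z) l m = bargmann A f l m + bargmann A g l m := by
  have := bargmann_sub hf (hg.const_mul (-1)) l m
  rw [bargmann_const_mul] at this
  simpa using this

theorem bargmann_zero (A : ℝ) (l m : ℂ) : bargmann A (fun _ => 0) l m = 0 := by
  simp [bargmann, gaussLaplace]

theorem bargmann_sum {A : ℝ} {ι : Type*} (s : Finset ι) {F : ι → ℂ → ℂ}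
    (h : ∀ i ∈ s, GaussTame A (F i)) (l m : ℂ) :
    bargmann A (fun z => ∑ i ∈ s, F i z) l m = ∑ i ∈ s, bargmann A (F i) l m := by
  classical
  induction s using Finset.induction_on with
  | empty => simpa using bargmann_zero A l m
  | insert i s hi ih =>
    simp only [Finset.sum_insert hi]
    rw [bargmann_add (h i (by simp)) (GaussTame.sum s fun j hj => h j (by simp [hj])),
      ih fun j hj => h j (by simp [hj])]

/-- The Bargmann transform is injective. -/
theorem eq_zero_of_bargmann_eq_zero {A : ℝ} {f : ℂ → ℂ} (hf : GaussTame A f)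
    (h : ∀ l m, bargmann A f l m = 0) (z : ℂ) : f z = 0 := by
  set φ : ℂ → ℂ := fun z => f z * Complex.exp (-(A : ℂ) * (‖z‖ : ℂ) ^ 2) with hφ
  have hc := hf.continuous
  have hφc : Continuous φ := by fun_prop
  have hφi : Integrable φ := by simpa [hφ] using hf.integrable_mul_cexp 0 0
  have hF : FourierTransform.fourier φ = 0 := by
    ext ξ
    rw [Real.fourier_eq']
    -- At these parameters the Laplace kernel is the Fourier kernel `exp(-2πi⟨v, ξ⟩)`, so the
    -- Fourier transform of `f` times the Gaussian vanishes.
    have h0 : gaussLaplace A f (-Real.pi * Complex.I * conj ξ) (-Real.pi * Complex.I * ξ) = 0 := by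
      have := h (-Real.pi * Complex.I * conj ξ) (-Real.pi * Complex.I * ξ)
      rw [bargmann] at this
      exact (mul_eq_zero.1 this).resolve_left (Complex.exp_ne_zero _)
    rw [Pi.zero_apply, ← h0, gaussLaplace]
    congr 1
    ext v
    rw [hφ, smul_eq_mul, mul_left_comm, ← Complex.exp_add]
    congr 2
    have : ((inner ℝ v ξ : ℝ) : ℂ) = (conj ξ * v + ξ * conj v) / 2 := by
      rw [Complex.inner, Complex.re_eq_add_conj]
      simp only [map_mul, Complex.conj_conj]
      ring
    push_cast
    rw [this]
    ring
  have hinv := hφc.fourierInv_fourier_eq hφi (by rw [hF]; exact integrable_zero _ _ _)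
  have hz : φ z = 0 := by
    rw [← hinv, hF, Real.fourierInv_eq']
    simp
  exact (mul_eq_zero.1 hz).resolve_right (Complex.exp_ne_zero _)

/-! ### Taylor coefficients of the Bargmann transform along lines through the origin -/

theorem iteratedDeriv_id_mul {g : ℂ → ℂ} (hg : Differentiable ℂ g) (n : ℕ) (x : ℂ) :
    iteratedDeriv n (fun t => t * g t) x
      = x * iteratedDeriv n g x + n * iteratedDeriv (n - 1) g x := by
  induction n generalizing g x with
  | zero => simp
  | succ n ih =>
    have hg' : Differentiable ℂ (deriv g) := (hg.contDiff (n := 2)).differentiable_deriv_two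
    have hd : deriv (fun t => t * g t) = fun t => g t + t * deriv g t := by
      ext t
      simpa using ((hasDerivAt_id t).fun_mul (hg t).hasDerivAt).deriv
    have hm : Differentiable ℂ fun t => t * deriv g t := differentiable_id.mul hg'
    rw [iteratedDeriv_succ', hd]
    have := iteratedDeriv_add (n := n) (x := x) hg.contDiff.contDiffAt hm.contDiff.contDiffAt
    rw [Pi.add_def] at this
    rw [this, ih hg', iteratedDeriv_succ', Nat.add_sub_cancel]
    rcases n with _ | n
    · simp; ring
    · rw [Nat.add_sub_cancel, ← iteratedDeriv_succ' (f := g) (n := n)]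
      push_cast
      ring

/-- The `n`-th derivative at `0` of `t ↦ bargmann A f (t * l) (t * m)`. -/
def bargmannCoeff (A : ℝ) (f : ℂ → ℂ) (n : ℕ) (l m : ℂ) : ℂ :=
  iteratedDeriv n (fun t => bargmann A f (t * l) (t * m)) 0

theorem hasDerivAt_bargmann {A : ℝ} {f : ℂ → ℂ} (hf : GaussTame A f) (l m t : ℂ) :
    HasDerivAt (fun t => bargmann A f (t * l) (t * m))
      (l * bargmann A (fun z => z * f z) (t * l) (t * m)
        + m * bargmann A (fun z => conj z * f z) (t * l) (t * m)
        + (-(l * m) / A) * (t * bargmann A f (t * l) (t * m))) t := by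
  have h1 := hasDerivAt_gaussLaplace hf 0 0 l m t
  simp only [zero_add] at h1
  have h2 : HasDerivAt (fun t : ℂ => -(t * l * (t * m)) / (2 * A)) (-(l * m) / A * t) t := by
    have := (((hasDerivAt_id t).mul_const l).fun_mul ((hasDerivAt_id t).mul_const m)).fun_neg.div_const
      (2 * (A : ℂ))
    refine this.congr_deriv ?_
    simp only [id]
    ring
  refine (h2.cexp.fun_mul h1).congr_deriv ?_
  simp only [bargmann]
  ring

theorem differentiable_bargmann {A : ℝ} {f : ℂ → ℂ} (hf : GaussTame A f) (l m : ℂ) :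
    Differentiable ℂ fun t => bargmann A f (t * l) (t * m) :=
  fun t => (hasDerivAt_bargmann hf l m t).differentiableAt

/-- This recursion in the degree gives homogeneity of the Taylor components without Taylor series in
two variables. The truncated `n - 1` at `n = 0` is harmless because of the factor `n`. -/
theorem bargmannCoeff_succ {A : ℝ} {f : ℂ → ℂ} (hf : GaussTame A f) (n : ℕ) (l m : ℂ) :
    bargmannCoeff A f (n + 1) l m = l * bargmannCoeff A (fun z => z * f z) n l m
      + m * bargmannCoeff A (fun z => conj z * f z) n l m
      + (-(l * m) / A) * (n * bargmannCoeff A f (n - 1) l m) := by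
  have hd : deriv (fun t => bargmann A f (t * l) (t * m)) =
      ((fun t => l * bargmann A (fun z => z * f z) (t * l) (t * m))
        + (fun t => m * bargmann A (fun z => conj z * f z) (t * l) (t * m)))
        + fun t => (-(l * m) / A) * (t * bargmann A f (t * l) (t * m)) :=
    funext fun t => (hasDerivAt_bargmann hf l m t).deriv
  have d1 := (differentiable_bargmann hf.id_mul l m).const_mul l
  have d2 := (differentiable_bargmann hf.conj_mul l m).const_mul m
  have d3 : Differentiable ℂ fun t : ℂ => (-(l * m) / A) * (t * bargmann A f (t * l) (t * m)) :=
    (differentiable_id.fun_mul (differentiable_bargmann hf l m)).const_mul (-(l * m) / A)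
  rw [bargmannCoeff, iteratedDeriv_succ', hd,
    iteratedDeriv_add (d1.add d2).contDiff.contDiffAt d3.contDiff.contDiffAt,
    iteratedDeriv_add d1.contDiff.contDiffAt d2.contDiff.contDiffAt,
    iteratedDeriv_const_mul_field, iteratedDeriv_const_mul_field, iteratedDeriv_const_mul_field,
    iteratedDeriv_id_mul (differentiable_bargmann hf l m)]
  simp [bargmannCoeff]

/-- Homogeneous polynomial functions of degree `n` in two variables. -/
def homogPoly (n : ℕ) : Submodule ℂ (ℂ → ℂ → ℂ) :=
  Submodule.span ℂ (Set.range fun (p : antidiagonal n) (l m : ℂ) =>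
    l ^ p.1.1 * m ^ p.1.2)

theorem mul_mem_homogPoly {n a b : ℕ} {φ : ℂ → ℂ → ℂ} (hφ : φ ∈ homogPoly n) :
    (fun l m => l ^ a * m ^ b * φ l m) ∈ homogPoly (n + a + b) := by
  unfold homogPoly at hφ
  induction hφ using Submodule.span_induction with
  | mem x h =>
    obtain ⟨⟨⟨i, j⟩, hp⟩, rfl⟩ := h
    rw [mem_antidiagonal] at hp
    refine Submodule.subset_span ⟨⟨(i + a, j + b), ?_⟩, ?_⟩
    · rw [mem_antidiagonal]; simp at hp ⊢; omega
    · ext l m; simp only; ring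
  | zero =>
    convert Submodule.zero_mem (homogPoly (n + a + b)) using 1
    ext l m; simp
  | add x y _ _ hx hy =>
    convert Submodule.add_mem _ hx hy using 1
    ext l m; simp [mul_add]
  | smul c x _ hx =>
    convert Submodule.smul_mem _ c hx using 1
    ext l m; simp only [Pi.smul_apply, smul_eq_mul]; ring

theorem bargmannCoeff_mem_homogPoly {A : ℝ} (n : ℕ) {f : ℂ → ℂ} (hf : GaussTame A f) :
    bargmannCoeff A f n ∈ homogPoly n := by
  induction n using Nat.strong_induction_on generalizing f with
  | _ n ih =>
    rcases n with _ | n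
    · have : bargmannCoeff A f 0 = bargmann A f 0 0 • fun l m : ℂ => l ^ 0 * m ^ 0 := by
        ext l m; simp [bargmannCoeff]
      rw [this]
      exact Submodule.smul_mem _ _ (Submodule.subset_span ⟨⟨(0, 0), by simp⟩, rfl⟩)
    · have h1 := mul_mem_homogPoly (a := 1) (b := 0) (ih n (by omega) hf.id_mul)
      have h2 := mul_mem_homogPoly (a := 0) (b := 1) (ih n (by omega) hf.conj_mul)
      have h3 : (fun l m => (n : ℂ) * (l ^ 1 * m ^ 1 * bargmannCoeff A f (n - 1) l m))
          ∈ homogPoly (n + 1) := by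
        rcases n with _ | n
        · convert Submodule.zero_mem (homogPoly 1) using 1
          ext l m; simp
        · exact Submodule.smul_mem _ ((n + 1 : ℕ) : ℂ)
            (mul_mem_homogPoly (a := 1) (b := 1) (ih n (by omega) hf))
      have e : bargmannCoeff A f (n + 1) =
          ((fun l m => l ^ 1 * m ^ 0 * bargmannCoeff A (fun z => z * f z) n l m)
          + fun l m => l ^ 0 * m ^ 1 * bargmannCoeff A (fun z => conj z * f z) n l m)
          + (-1 / (A : ℂ)) • fun l m => (n : ℂ) * (l ^ 1 * m ^ 1 * bargmannCoeff A f (n - 1) l m) := by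
        ext l m
        rw [bargmannCoeff_succ hf]
        simp only [Pi.add_apply, Pi.smul_apply, smul_eq_mul]
        ring
      rw [e]
      exact Submodule.add_mem _ (Submodule.add_mem _ h1 h2) (Submodule.smul_mem _ _ h3)

theorem exists_of_mem_homogPoly {n : ℕ} {φ : ℂ → ℂ → ℂ} (hφ : φ ∈ homogPoly n) :
    ∃ c : ℕ × ℕ → ℂ, ∀ l m, φ l m = ∑ p ∈ antidiagonal n, c p * (l ^ p.1 * m ^ p.2) := by
  classical
  obtain ⟨c, rfl⟩ := (Submodule.mem_span_range_iff_exists_fun ℂ).1 hφ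
  refine ⟨fun p => if h : p ∈ antidiagonal n then c ⟨p, h⟩ else 0, fun l m => ?_⟩
  rw [← Finset.sum_coe_sort (antidiagonal n)]
  simp

theorem mul_smul_homogPoly {n : ℕ} {φ : ℂ → ℂ → ℂ} (hφ : φ ∈ homogPoly n) (s l m : ℂ) :
    φ (s * l) (s * m) = s ^ n * φ l m := by
  obtain ⟨c, hc⟩ := exists_of_mem_homogPoly hφ
  rw [hc, hc, Finset.mul_sum]
  refine Finset.sum_congr rfl fun p hp => ?_
  rw [← mem_antidiagonal.1 hp]
  ring

theorem tsum_bargmannCoeff {A : ℝ} {f : ℂ → ℂ} (hf : GaussTame A f) (l m : ℂ) :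
    ∑' n : ℕ, (n.factorial : ℂ)⁻¹ * bargmannCoeff A f n l m = bargmann A f l m := by
  simpa [bargmannCoeff] using
    Complex.taylorSeries_eq_of_entire' 0 1 (differentiable_bargmann hf l m)

theorem bargmannCoeff_add {A : ℝ} {f g : ℂ → ℂ} (hf : GaussTame A f) (hg : GaussTame A g)
    (n : ℕ) (l m : ℂ) : bargmannCoeff A (fun z => f z + g z) n l m
      = bargmannCoeff A f n l m + bargmannCoeff A g n l m := by
  simp only [bargmannCoeff, bargmann_add hf hg]
  exact iteratedDeriv_add (differentiable_bargmann hf l m).contDiff.contDiffAt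
    (differentiable_bargmann hg l m).contDiff.contDiffAt

theorem bargmannCoeff_const_mul {A : ℝ} {f : ℂ → ℂ} (a : ℂ) (n : ℕ) (l m : ℂ) :
    bargmannCoeff A (fun z => a * f z) n l m = a * bargmannCoeff A f n l m := by
  simp only [bargmannCoeff, bargmann_const_mul, iteratedDeriv_const_mul_field]

theorem bargmannCoeff_zero (A : ℝ) (n : ℕ) (l m : ℂ) :
    bargmannCoeff A (fun _ => 0) n l m = 0 := by
  simpa using bargmannCoeff_const_mul (A := A) (f := fun _ => 0) 0 n l m

theorem bargmannCoeff_sum {A : ℝ} {ι : Type*} (s : Finset ι) {F : ι → ℂ → ℂ}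
    (h : ∀ i ∈ s, GaussTame A (F i)) (n : ℕ) (l m : ℂ) :
    bargmannCoeff A (fun z => ∑ i ∈ s, F i z) n l m = ∑ i ∈ s, bargmannCoeff A (F i) n l m := by
  classical
  induction s using Finset.induction_on with
  | empty => simpa using bargmannCoeff_zero A n l m
  | insert i s hi ih =>
    simp only [Finset.sum_insert hi]
    rw [bargmannCoeff_add (h i (by simp)) (GaussTame.sum s fun j hj => h j (by simp [hj])),
      ih fun j hj => h j (by simp [hj])]

/-- The Taylor coefficients are bounded by the supremum norm. -/
theorem exists_norm_bargmannCoeff_le {A : ℝ} (hA : 0 < A) (n : ℕ) (l m : ℂ) :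
    ∃ K : ℝ, ∀ (f : ℂ → ℂ) (C : ℝ), Continuous f → (∀ z, ‖f z‖ ≤ C) →
      ‖bargmannCoeff A f n l m‖ ≤ C * K := by
  set I := ∫ z : ℂ, Real.exp (-A * ‖z‖ ^ 2 + (‖l‖ + ‖m‖) * ‖z‖)
  set E := Real.exp (‖l‖ * ‖m‖ / (2 * A))
  refine ⟨n.factorial * (E * I), fun f C hf hC => ?_⟩
  have hC0 : 0 ≤ C := (norm_nonneg _).trans (hC 0)
  have ht := GaussTame.of_bounded hA hf hC
  -- Cauchy's estimate on the unit circle, where the transform is bounded by `C` times a convergent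
  -- Gaussian integral.
  have := Complex.norm_iteratedDeriv_le_of_forall_mem_sphere_norm_le n (C := E * (C * I))
    one_pos (differentiable_bargmann ht l m).diffContOnCl (c := 0) fun t ht' => ?_
  · refine this.trans (le_of_eq ?_)
    simp; ring
  · have ht1 : ‖t‖ = 1 := by simpa using ht'
    rw [bargmann, norm_mul]
    refine mul_le_mul ?_ ?_ (norm_nonneg _) (Real.exp_pos _).le
    · rw [Complex.norm_exp]
      refine Real.exp_le_exp.2 ((Complex.re_le_norm _).trans (le_of_eq ?_))
      rw [norm_div, norm_neg, norm_mul, norm_mul, norm_mul, norm_mul, ht1,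
        Complex.norm_of_nonneg hA.le]
      simp
    · rw [gaussLaplace, ← integral_const_mul]
      refine norm_integral_le_of_norm_le ((integrable_exp_neg_mul_sq_norm_add hA _).const_mul C)
        (Filter.Eventually.of_forall fun z => ?_)
      rw [norm_mul]
      refine mul_le_mul (hC z) (norm_cexp_gauss_le A _ _ z ?_) (norm_nonneg _) hC0
      rw [norm_mul, norm_mul, ht1, one_mul, one_mul]

/-! ### Complex Hermite functions -/

/-- Complex Hermite (Itô) polynomials in `z` and `conj z`. -/
def complexHermite (A : ℝ) : ℕ → ℕ → ℂ → ℂ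
  | 0, j, z => conj z ^ j
  | k + 1, j, z => z * complexHermite A k j z - j / (2 * A) * complexHermite A k (j - 1) z

/-- Complex Hermite functions. -/
def hermiteFun (A : ℝ) (k j : ℕ) (z : ℂ) : ℂ :=
  complexHermite A k j z * Complex.exp (-(A : ℂ) * (‖z‖ : ℂ) ^ 2)

theorem hermiteFun_zero_succ (A : ℝ) (j : ℕ) :
    hermiteFun A 0 (j + 1) = fun z => conj z * hermiteFun A 0 j z := by
  ext z; simp only [hermiteFun, complexHermite]; ring

theorem hermiteFun_succ (A : ℝ) (k j : ℕ) :
    hermiteFun A (k + 1) j = fun z => z * hermiteFun A k j z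
      - j / (2 * A) * hermiteFun A k (j - 1) z := by
  ext z; simp only [hermiteFun, complexHermite]; ring

theorem norm_cexp_neg_mul_sq (A : ℝ) (z : ℂ) :
    ‖Complex.exp (-(A : ℂ) * (‖z‖ : ℂ) ^ 2)‖ = Real.exp (-A * ‖z‖ ^ 2) := by
  rw [Complex.norm_exp, ← Complex.ofReal_pow, ← Complex.ofReal_neg, ← Complex.ofReal_mul,
    Complex.ofReal_re]

theorem gaussTame_hermiteFun {A : ℝ} (hA : 0 < A) (k j : ℕ) : GaussTame A (hermiteFun A k j) := by
  induction k generalizing j with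
  | zero =>
    induction j with
    | zero =>
      have : hermiteFun A 0 0 = fun z => Complex.exp (-(A : ℂ) * (‖z‖ : ℂ) ^ 2) := by
        ext z; simp [hermiteFun, complexHermite]
      rw [this]
      refine GaussTame.of_bounded hA (by fun_prop) (C := 1) fun z => ?_
      rw [norm_cexp_neg_mul_sq]
      exact Real.exp_le_one_iff.2 (by nlinarith [sq_nonneg ‖z‖])
    | succ j ih => rw [hermiteFun_zero_succ]; exact ih.conj_mul
  | succ k ih =>
    rw [hermiteFun_succ]
    exact (ih j).id_mul.sub ((ih (j - 1)).const_mul _)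

/-- Multiplication by `z` or `conj z` is differentiation in `x` or `y`. In the step in `k` the
correction term of the Hermite recursion cancels exactly the derivative of `x ^ j`, so a single
monomial times the exponential remains. -/
theorem gaussLaplace_hermiteFun {A : ℝ} (hA : 0 < A) (k j : ℕ) (x y : ℂ) :
    gaussLaplace A (hermiteFun A k j) x y = Real.pi / (2 * A) / (2 * A) ^ (k + j)
      * (y ^ k * x ^ j) * Complex.exp (x * y / (2 * A)) := by
  have hA' : (A : ℂ) ≠ 0 := by exact_mod_cast hA.ne'
  induction k generalizing j x y with
  | zero =>
    induction j generalizing x y with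
    | zero =>
      have := integral_cexp_quadratic_complex (A := 2 * A) (by positivity) 0 x y
      have e : ∀ z : ℂ, hermiteFun A 0 0 z *
          Complex.exp (-(A : ℂ) * (‖z‖ : ℂ) ^ 2 + x * z + y * conj z) =
          Complex.exp (-((2 * A : ℝ) : ℂ) * (‖z‖ : ℂ) ^ 2
        + Complex.I * (0 * z ^ 2 + conj 0 * (conj z) ^ 2) + x * z + y * conj z) := by
        intro z
        simp only [hermiteFun, complexHermite, pow_zero, one_mul]
        rw [← Complex.exp_add]
        congr 1
        push_cast
        simp only [map_zero]
        ring
      simp only [gaussLaplace, e, this]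
      have hs : Real.sqrt ((2 * A) ^ 2 + 4 * ‖(0 : ℂ)‖ ^ 2) = 2 * A := by
        rw [norm_zero]
        simpa using Real.sqrt_sq (by positivity : 0 ≤ 2 * A)
      rw [hs]
      push_cast
      simp only [map_zero, norm_zero]
      congr 2
      · simp
      · field_simp
        simp only [mul_zero, add_zero, Complex.ofReal_zero, zero_pow two_ne_zero]
        ring
    | succ j ih =>
      have h1 := hasDerivAt_gaussLaplace (gaussTame_hermiteFun hA 0 j) x 0 0 1 y
      simp only [mul_zero, add_zero, mul_one, zero_add, zero_mul, one_mul, ih] at h1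
      rw [hermiteFun_zero_succ]
      refine h1.unique ?_
      have h2 : HasDerivAt (fun t : ℂ => x * t / (2 * A)) (x / (2 * A)) y := by
        simpa using ((hasDerivAt_id y).const_mul x).div_const (2 * (A : ℂ))
      simp only [pow_zero, one_mul]
      refine (h2.cexp.const_mul _).congr_deriv ?_
      field_simp
      ring
  | succ k ih =>
    have h1 := hasDerivAt_gaussLaplace (gaussTame_hermiteFun hA k j) 0 y 1 0 x
    simp only [mul_zero, add_zero, mul_one, zero_add, zero_mul, one_mul, ih] at h1
    have h2 : HasDerivAt (fun t : ℂ => t * y / (2 * A)) (y / (2 * A)) x := by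
      simpa using ((hasDerivAt_id x).mul_const y).div_const (2 * (A : ℂ))
    have h3 := (((hasDerivAt_pow j x).const_mul (y ^ k)).const_mul
      (Real.pi / (2 * A) / (2 * A) ^ (k + j) : ℂ)).fun_mul h2.cexp
    rw [hermiteFun_succ, gaussLaplace_sub (gaussTame_hermiteFun hA k j).id_mul
      ((gaussTame_hermiteFun hA k (j - 1)).const_mul _), gaussLaplace_const_mul, ih, h1.unique h3]
    rcases j with _ | j
    · simp only [Nat.cast_zero, zero_mul, mul_zero, zero_add, add_zero, zero_div, sub_zero]
      field_simp
      ring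
    · simp only [Nat.add_sub_cancel]
      field_simp
      push_cast
      ring

theorem bargmann_hermiteFun {A : ℝ} (hA : 0 < A) (k j : ℕ) (x y : ℂ) :
    bargmann A (hermiteFun A k j) x y =
      Real.pi / (2 * A) / (2 * A) ^ (k + j) * (y ^ k * x ^ j) := by
  rw [bargmann, gaussLaplace_hermiteFun hA, mul_comm, mul_assoc, ← Complex.exp_add, neg_div,
    add_neg_cancel, Complex.exp_zero, mul_one]

/-- A function whose Bargmann transform is homogeneous is a combination of Hermite functions. -/
theorem exists_eq_sum_hermiteFun {A : ℝ} (hA : 0 < A) {f : ℂ → ℂ} (hf : GaussTame A f) {n : ℕ}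
    (h : ∀ k ≠ n, ∀ l m, bargmannCoeff A f k l m = 0) :
    ∃ b : ℕ × ℕ → ℂ, ∀ z, f z = ∑ p ∈ antidiagonal n, b p * hermiteFun A p.1 p.2 z := by
  have hA' : (A : ℂ) ≠ 0 := by exact_mod_cast hA.ne'
  obtain ⟨c, hc⟩ := exists_of_mem_homogPoly (bargmannCoeff_mem_homogPoly n hf)
  set K : ℂ := (n.factorial : ℂ)⁻¹ / (Real.pi / (2 * A) / (2 * A) ^ n) with hK
  have hpi : (Real.pi : ℂ) ≠ 0 := by exact_mod_cast Real.pi_ne_zero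
  have hB : ∀ l m, bargmann A f l m =
      (n.factorial : ℂ)⁻¹ * ∑ p ∈ antidiagonal n, c p * (l ^ p.1 * m ^ p.2) := by
    intro l m
    rw [← tsum_bargmannCoeff hf, tsum_eq_single n, hc]
    intro k hk
    rw [h k hk, mul_zero]
  -- The swap appears because `hermiteFun A k j` has transform proportional to `m ^ k * l ^ j`; `K`
  -- combines the Taylor factor `1/n!` with the inverse of that constant.
  refine ⟨fun p => K * c p.swap, fun z => ?_⟩
  have ht : ∀ p ∈ antidiagonal n,
      GaussTame A fun z => K * c p.swap * hermiteFun A p.1 p.2 z :=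
    fun p _ => (gaussTame_hermiteFun hA _ _).const_mul _
  refine sub_eq_zero.1 (eq_zero_of_bargmann_eq_zero (hf.sub (GaussTame.sum _ ht)) ?_ z)
  intro l m
  rw [bargmann_sub hf (GaussTame.sum _ ht), bargmann_sum _ ht, hB, sub_eq_zero, Finset.mul_sum,
    ← Finset.Nat.sum_antidiagonal_swap]
  refine Finset.sum_congr rfl fun p hp => ?_
  rw [bargmann_const_mul, bargmann_hermiteFun hA, mem_antidiagonal.1 hp, hK]
  simp only [Prod.fst_swap, Prod.snd_swap]
  field_simp

/-! ### Equivariance of the Bargmann transform -/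

theorem special_unitary_entries {g : Matrix.SpecialLinearGroup (Fin 2) ℂ}
    (hg : (g : Matrix (Fin 2) (Fin 2) ℂ) ∈ Matrix.unitaryGroup (Fin 2) ℂ) :
    g 1 1 = conj (g 0 0) ∧ g 0 1 = -conj (g 1 0) ∧
      g 0 0 * conj (g 0 0) + g 1 0 * conj (g 1 0) = 1 := by
  have h := Matrix.mem_unitaryGroup_iff'.1 hg
  have h00 := congrFun (congrFun h 0) 0
  have h01 := congrFun (congrFun h 0) 1
  simp only [Matrix.mul_apply, Fin.sum_univ_two, Matrix.star_apply, Matrix.one_apply_eq,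
    RCLike.star_def, Matrix.one_apply_ne (zero_ne_one (α := Fin 2))] at h00 h01
  have hd := g.det_coe
  rw [Matrix.det_fin_two] at hd
  refine ⟨?_, ?_, by linear_combination h00⟩
  · linear_combination (-g 1 1) * h00 + g 1 0 * h01 + conj (g 0 0) * hd
  · linear_combination (-g 0 1) * h00 + g 0 0 * h01 - conj (g 1 0) * hd

theorem addChar_eq (c z : ℂ) :
    addChar c z = Complex.exp (Complex.I * (Real.pi / 2) * (c * z + conj c * conj z)) := by
  rw [addChar]
  congr 1
  push_cast
  rw [Complex.re_eq_add_conj, map_mul]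
  ring

theorem norm_addChar (c z : ℂ) : ‖addChar c z‖ = 1 := by
  rw [addChar, Complex.norm_exp_ofReal_mul_I]

theorem continuous_addChar (c : ℂ) : Continuous (addChar c) := by
  unfold addChar
  fun_prop

/-- The comparison of Gaussian exponents behind equivariance. Here `P` stands for `π‖c‖`, `e` for
`c/‖c‖`, `v` for `u/γ`, and primes for conjugates. Treating conjugates as independent variables
makes it a rational identity modulo `e e' = 1`, `a a' + g g' = 1` and `I² = -1`. -/
theorem weil_exponent {P e e' a a' g g' : ℂ} (l m v v' : ℂ) (hP : P ≠ 0) (hg : g ≠ 0)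
    (hg' : g' ≠ 0) (hee : e * e' = 1) (haa : a * a' + g * g' = 1) :
    (P * (l - Complex.I * P * e * v) * (m - Complex.I * P * e' * v')
      + Complex.I * (P * e' * a' / (2 * g') * (l - Complex.I * P * e * v) ^ 2
        + P * e * a / (2 * g) * (m - Complex.I * P * e' * v') ^ 2)) / (P ^ 2 / (g * g'))
      + Complex.I * (P * e * a' / (2 * g) * (g * v) ^ 2 + P * e' * a / (2 * g') * (g' * v') ^ 2)
      + -(l * m) / (2 * P)
    = -((a' * l - Complex.I * e * g' * m) * (a * m - Complex.I * e' * g * l)) / (2 * P)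
      + (-P * (g * v * (g' * v')) + (a' * l - Complex.I * e * g' * m) * (g * v)
        + (a * m - Complex.I * e' * g * l) * (g' * v')) := by
  have hI := Complex.I_sq
  field_simp
  linear_combination (-2 * P ^ 2 * g * g' * v * v' - g * g' * l * m + 2 * P * g * a' * l * v
      + 2 * P * g' * a * m * v' - Complex.I * P ^ 2 * (g * a' * e * v ^ 2 + g' * a * e' * v' ^ 2))
        * hee + l * m * haa
    + (2 * g * g' * P ^ 2 * e * e' * v * v' - 2 * P * g * a' * e * e' * l * v
      - 2 * P * g' * a * e * e' * m * v'
      + Complex.I * P ^ 2 * (g * a' * e' * e ^ 2 * v ^ 2 + g' * a * e * e' ^ 2 * v' ^ 2)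
      + e * e' * g * g' * l * m) * hI

/-- The Bargmann transform turns the Weil representation of `SU(2)` into a linear substitution. -/
theorem bargmann_weilAction {c : ℂ} (hc : c ≠ 0) {g : Matrix.SpecialLinearGroup (Fin 2) ℂ}
    (hg : (g : Matrix (Fin 2) (Fin 2) ℂ) ∈ Matrix.unitaryGroup (Fin 2) ℂ)
    (f : 𝓢(ℂ, ℂ)) {h : ℂ → ℂ} (hh : ∀ z, h z = weilAction c g f z) (l m : ℂ) :
    bargmann (Real.pi * ‖c‖) h l m = bargmann (Real.pi * ‖c‖) f
      (conj (g 0 0) * l - Complex.I * (c / ‖c‖) * conj (g 1 0) * m)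
      (g 0 0 * m - Complex.I * (conj c / ‖c‖) * g 1 0 * l) := by
  obtain ⟨h11, h01, hsum⟩ := special_unitary_entries hg
  have hn : 0 < ‖c‖ := norm_pos_iff.2 hc
  have hn' : (‖c‖ : ℂ) ≠ 0 := by exact_mod_cast hn.ne'
  have hpi : (Real.pi : ℂ) ≠ 0 := by exact_mod_cast Real.pi_ne_zero
  have hA : 0 < Real.pi * ‖c‖ := mul_pos Real.pi_pos hn
  rcases eq_or_ne (g 1 0) 0 with h10 | h10
  · have ha : ‖g 0 0‖ = 1 := by
      rw [h10, zero_mul, add_zero, Complex.mul_conj'] at hsum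
      have : ‖g 0 0‖ ^ 2 = 1 := by exact_mod_cast hsum
      exact (pow_eq_one_iff_of_nonneg (norm_nonneg _) two_ne_zero).1 this
    have haa : g 0 0 * conj (g 0 0) = 1 := by simpa [h10] using hsum
    have hh' : h = fun z => f (g 0 0 * z) := by
      ext z
      rw [hh, weilAction, if_pos h10, ha, h01, h10]
      simp [addChar]
    obtain ⟨u, hu⟩ : ∃ u : Circle, (u : ℂ) = g 0 0 :=
      ⟨⟨g 0 0, mem_sphere_zero_iff_norm.2 ha⟩, rfl⟩
    rw [hh', h10, ← hu]
    rw [← hu] at haa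
    simp only [map_zero, mul_zero, zero_mul, sub_zero, bargmann]
    congr 1
    · congr 1
      linear_combination (l * m / (2 * ((Real.pi * ‖c‖ : ℝ) : ℂ))) * haa
    · unfold gaussLaplace
      refine Eq.trans ?_ (((rotation u).measurePreserving).integral_comp
        (rotation u).toHomeomorph.measurableEmbedding _)
      congr 1
      ext z
      rw [LinearIsometryEquiv.norm_map, rotation_apply, map_mul (starRingEnd ℂ)]
      congr 2
      linear_combination (-(l * z) - m * conj z) * haa
  · set γ := g 1 0
    set a := g 0 0
    have hγ' : conj γ ≠ 0 := (map_ne_zero _).2 h10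
    have hγn : 0 < ‖γ‖ := norm_pos_iff.2 h10
    set A := Real.pi * ‖c‖ with hAdef
    set E : ℂ → ℂ := fun z => Complex.exp (-(A : ℂ) * (‖z‖ : ℂ) ^ 2 + l * z + m * conj z) with hE
    have hEi : Integrable E := by
      simpa [hE] using (GaussTame.of_bounded (f := fun _ => 1) hA continuous_const
        (C := 1) (by simp)).integrable_mul_cexp l m
    have hEc : Continuous E := by fun_prop
    have hfc : Continuous f := f.continuous
    set k : ℂ := ((‖c‖ / ‖γ‖ : ℝ) : ℂ)
    have hadd := continuous_addChar c
    -- Fubini: the Gaussian integral in `z` is carried out first, with `f` left as a weight in `u`.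
    have hswap : gaussLaplace A h l m = ∫ u : ℂ, f u * (k * ∫ z : ℂ,
        addChar c ((a * z ^ 2 - 2 * z * u + conj a * u ^ 2) / γ) * E z) := by
      have e1 : gaussLaplace A h l m = ∫ z : ℂ, ∫ u : ℂ,
          k * (addChar c ((a * z ^ 2 - 2 * z * u + conj a * u ^ 2) / γ) * f u * E z) := by
        rw [gaussLaplace]
        congr 1
        ext z
        rw [hh, weilAction, if_neg h10, h11, ← integral_const_mul, ← integral_mul_const]
        congr 1
        ext u
        simp only [hE, k]
        ring
      rw [e1, integral_integral_swap]
      · congr 1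
        ext u
        rw [← integral_const_mul, ← integral_const_mul]
        congr 1
        ext z
        ring
      · refine Integrable.const_mul ?_ k
        refine (hEi.mul_prod f.integrable).norm.mono' ?_ (Filter.Eventually.of_forall ?_)
        · apply Continuous.aestronglyMeasurable
          fun_prop
        · rintro ⟨z, u⟩
          simp only [norm_mul, norm_addChar]
          linarith [mul_comm ‖f u‖ ‖E z‖]
    have hcc : (c / ‖c‖) * (conj c / ‖c‖) = 1 := by
      rw [div_mul_div_comm, Complex.mul_conj']
      field_simp
    have hγγ : γ * conj γ = (‖γ‖ : ℂ) ^ 2 := Complex.mul_conj' γ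
    have haa : a * conj a = (‖a‖ : ℂ) ^ 2 := Complex.mul_conj' a
    have hsumn : ‖a‖ ^ 2 + ‖γ‖ ^ 2 = 1 := by
      rw [haa, hγγ] at hsum
      exact_mod_cast hsum
    set β : ℂ := Real.pi * c * a / (2 * γ) with hβ
    -- Unitarity `‖a‖² + ‖γ‖² = 1` and the choice `A = π‖c‖` make the Gaussian determinant a perfect
    -- square; its root then cancels the factor `‖c‖/‖γ‖` of the Weil action.
    have hD : A ^ 2 + 4 * ‖β‖ ^ 2 = (A / ‖γ‖) ^ 2 := by
      have : ‖β‖ = A * ‖a‖ / (2 * ‖γ‖) := by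
        rw [hβ, norm_div, norm_mul, norm_mul, norm_mul, Complex.norm_of_nonneg Real.pi_pos.le,
          Complex.norm_two]
      rw [this, div_pow, div_pow, ← mul_one (A ^ 2 / ‖γ‖ ^ 2), ← hsumn]
      field_simp
      ring
    have hinner : ∀ u : ℂ, k * ∫ z : ℂ,
        addChar c ((a * z ^ 2 - 2 * z * u + conj a * u ^ 2) / γ) * E z =
        Complex.exp ((A * (l - Complex.I * A * (c / ‖c‖) * (u / γ))
            * (m - Complex.I * A * (conj c / ‖c‖) * (conj u / conj γ))
          + Complex.I * (conj β * (l - Complex.I * A * (c / ‖c‖) * (u / γ)) ^ 2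
            + β * (m - Complex.I * A * (conj c / ‖c‖) * (conj u / conj γ)) ^ 2))
            / ((A ^ 2 + 4 * ‖β‖ ^ 2 : ℝ) : ℂ)
          + Complex.I * (Real.pi / 2) * (c * (conj a * u ^ 2 / γ)
            + conj c * (a * conj u ^ 2 / conj γ))) := by
      intro u
      have e2 : ∀ z : ℂ, addChar c ((a * z ^ 2 - 2 * z * u + conj a * u ^ 2) / γ) * E z =
          Complex.exp (-(A : ℂ) * (‖z‖ : ℂ) ^ 2
            + Complex.I * (β * z ^ 2 + conj β * (conj z) ^ 2)
            + (l - Complex.I * A * (c / ‖c‖) * (u / γ)) * z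
            + (m - Complex.I * A * (conj c / ‖c‖) * (conj u / conj γ)) * conj z) *
          Complex.exp (Complex.I * (Real.pi / 2) * (c * (conj a * u ^ 2 / γ)
            + conj c * (a * conj u ^ 2 / conj γ))) := by
        intro z
        rw [addChar_eq, hE, ← Complex.exp_add, ← Complex.exp_add, hβ, hAdef]
        congr 1
        simp only [map_div₀, map_add, map_sub, map_mul, map_pow, Complex.conj_conj, map_ofNat,
          Complex.conj_ofReal]
        push_cast
        field_simp
        ring
      simp_rw [e2]
      rw [integral_mul_const, integral_cexp_quadratic_complex hA, ← mul_assoc, ← mul_assoc,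
        Complex.exp_add]
      congr 1
      rw [hD, Real.sqrt_sq (by positivity), ← Complex.ofReal_mul]
      have : ‖c‖ / ‖γ‖ * (Real.pi / (A / ‖γ‖)) = 1 := by
        rw [hAdef]; field_simp
      rw [this]
      simp
    rw [bargmann, bargmann, hswap, gaussLaplace, ← integral_const_mul, ← integral_const_mul]
    congr 1
    ext u
    rw [hinner, mul_left_comm, mul_left_comm (Complex.exp _), ← Complex.exp_add,
      ← Complex.exp_add]
    congr 2
    have hA' : (A : ℂ) ≠ 0 := by exact_mod_cast hA.ne'
    have key := weil_exponent l m (u / γ) (conj u / conj γ) hA' h10 hγ' hcc hsum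
    have hAc : (A : ℂ) = Real.pi * ‖c‖ := by rw [hAdef]; push_cast; rfl
    rw [mul_div_cancel₀ _ h10, mul_div_cancel₀ _ hγ'] at key
    rw [← Complex.mul_conj' u, ← key, hD]
    have hb1 : conj β = A * (conj c / ‖c‖) * conj a / (2 * conj γ) := by
      rw [hβ, hAc]
      simp only [map_div₀, map_mul, Complex.conj_ofReal, map_ofNat]
      field_simp
    have hb2 : β = A * (c / ‖c‖) * a / (2 * γ) := by
      rw [hβ, hAc]
      field_simp
    rw [hb1, hb2]
    push_cast
    rw [div_pow, ← hγγ]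
    have hY : Complex.I * (Real.pi / 2) * (c * (conj a * u ^ 2 / γ)
        + conj c * (a * conj u ^ 2 / conj γ)) = Complex.I *
          (A * (c / ‖c‖) * conj a / (2 * γ) * u ^ 2 +
            A * (conj c / ‖c‖) * a / (2 * conj γ) * conj u ^ 2) := by
      rw [hAc]
      field_simp
    rw [hY]
    ring

/-! ### Irreducible subspaces consist of functions with homogeneous Bargmann transform -/

theorem gaussTame_schwartz {A : ℝ} (hA : 0 < A) (f : 𝓢(ℂ, ℂ)) : GaussTame A f :=
  GaussTame.of_bounded hA f.continuous
    fun z => BoundedContinuousFunction.norm_coe_le_norm f.toBoundedContinuousFunction z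

theorem continuous_bargmannCoeff {A : ℝ} (hA : 0 < A) (n : ℕ) (l m : ℂ) :
    Continuous fun f : 𝓢(ℂ, ℂ) => bargmannCoeff A f n l m := by
  obtain ⟨K, hK⟩ := exists_norm_bargmannCoeff_le hA n l m
  have ht : ∀ f : BoundedContinuousFunction ℂ ℂ, GaussTame A f := fun f =>
    GaussTame.of_bounded hA f.continuous fun z => f.norm_coe_le_norm z
  let φ : BoundedContinuousFunction ℂ ℂ →ₗ[ℂ] ℂ :=
    { toFun := fun f => bargmannCoeff A f n l m
      map_add' := fun f g => bargmannCoeff_add (ht f) (ht g) n l m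
      map_smul' := fun a f => bargmannCoeff_const_mul (f := f) a n l m }
  have hφ : Continuous φ := (φ.mkContinuous K fun f =>
    (hK f ‖f‖ f.continuous fun z => f.norm_coe_le_norm z).trans (mul_comm _ _).le).continuous
  exact hφ.comp (SchwartzMap.toBoundedContinuousFunctionCLM ℂ ℂ ℂ).continuous

theorem bargmannCoeff_weilAction {c : ℂ} (hc : c ≠ 0) {g : Matrix.SpecialLinearGroup (Fin 2) ℂ}
    (hg : (g : Matrix (Fin 2) (Fin 2) ℂ) ∈ Matrix.unitaryGroup (Fin 2) ℂ)
    (f : 𝓢(ℂ, ℂ)) {h : ℂ → ℂ} (hh : ∀ z, h z = weilAction c g f z) (n : ℕ) (l m : ℂ) :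
    bargmannCoeff (Real.pi * ‖c‖) h n l m = bargmannCoeff (Real.pi * ‖c‖) f n
      (conj (g 0 0) * l - Complex.I * (c / ‖c‖) * conj (g 1 0) * m)
      (g 0 0 * m - Complex.I * (conj c / ‖c‖) * g 1 0 * l) := by
  unfold bargmannCoeff
  congr 1
  ext t
  rw [bargmann_weilAction hc hg f hh]
  congr 1 <;> ring

/-- The element of `SU(2)` with first column `(a, b)`. -/
theorem exists_special_unitary {a b : ℂ} (h : a * conj a + b * conj b = 1) :
    ∃ g : Matrix.SpecialLinearGroup (Fin 2) ℂ,
      (g : Matrix (Fin 2) (Fin 2) ℂ) ∈ Matrix.unitaryGroup (Fin 2) ℂ ∧ g 0 0 = a ∧ g 1 0 = b := by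
  refine ⟨⟨!![a, -conj b; b, conj a], ?_⟩, ?_, rfl, rfl⟩
  · rw [Matrix.det_fin_two_of]; linear_combination h
  · rw [Matrix.mem_unitaryGroup_iff']
    ext i j
    fin_cases i <;> fin_cases j <;> simp [Matrix.mul_apply, Fin.sum_univ_two]
    · linear_combination h
    · ring
    · ring
    · linear_combination h

/-- A highest weight argument: `l ^ k` has a torus weight that does not occur in degree `n < k`.
Projecting onto that weight inside `V` kills the degree `n` component, hence the vector by
injectivity, although its `l ^ k` coefficient would be nonzero. -/
theorem bargmannCoeff_eq_zero_of_lt {c : ℂ} (hc : c ≠ 0) {V : Submodule ℂ 𝓢(ℂ, ℂ)}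
    (hV : IsWeilInvariant c V) {n k : ℕ} (hnk : n < k)
    (hn : ∀ f ∈ V, (∀ l m, bargmannCoeff (Real.pi * ‖c‖) f n l m = 0) → f = 0)
    (f : 𝓢(ℂ, ℂ)) (hf : f ∈ V) (l m : ℂ) : bargmannCoeff (Real.pi * ‖c‖) f k l m = 0 := by
  have hcn : 0 < ‖c‖ := norm_pos_iff.2 hc
  have hcn' : (‖c‖ : ℂ) ≠ 0 := by exact_mod_cast hcn.ne'
  have hA : 0 < Real.pi * ‖c‖ := mul_pos Real.pi_pos hcn
  have hcc : conj c / ‖c‖ * (c / ‖c‖) = 1 := by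
    rw [div_mul_div_comm, Complex.conj_mul']
    field_simp
  by_contra hne
  have hhom := fun (f : 𝓢(ℂ, ℂ)) (n : ℕ) =>
    bargmannCoeff_mem_homogPoly (A := Real.pi * ‖c‖) n (gaussTame_schwartz hA f)
  -- `SU(2)` is transitive on the unit sphere of `ℂ²`, so by homogeneity a point of nonvanishing can
  -- be moved to `(1, 0)`, where the value is the coefficient of `l ^ k`.
  obtain ⟨f₁, hf₁, h₁⟩ : ∃ f₁ ∈ V, bargmannCoeff (Real.pi * ‖c‖) f₁ k 1 0 ≠ 0 := by
    set r : ℝ := Real.sqrt (‖l‖ ^ 2 + ‖m‖ ^ 2) with hr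
    have hr2 : r ^ 2 = ‖l‖ ^ 2 + ‖m‖ ^ 2 := Real.sq_sqrt (by positivity)
    have hr0 : (r : ℂ) ≠ 0 := by
      intro h0
      have h0' : r = 0 := by exact_mod_cast h0
      rw [h0'] at hr2
      have hl : l = 0 := norm_eq_zero.1 (by nlinarith [sq_nonneg ‖l‖, sq_nonneg ‖m‖])
      have hm : m = 0 := norm_eq_zero.1 (by nlinarith [sq_nonneg ‖l‖, sq_nonneg ‖m‖])
      have := mul_smul_homogPoly (hhom f k) 0 l m
      rw [zero_pow (by omega), zero_mul, zero_mul, zero_mul] at this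
      rw [hl, hm] at hne
      exact hne this
    have hrc : (r : ℂ) ^ 2 = l * conj l + m * conj m := by
      rw [Complex.mul_conj', Complex.mul_conj']
      exact_mod_cast hr2
    obtain ⟨g, hg, hg0, hg1⟩ := exists_special_unitary (a := conj l / r)
      (b := Complex.I * (c / ‖c‖) * (m / r)) (by
        simp only [map_mul, map_div₀, Complex.conj_conj, Complex.conj_ofReal, Complex.conj_I]
        have : conj l / r * (l / r) + Complex.I * (c / ‖c‖) * (m / r)
            * (-Complex.I * (conj c / ‖c‖) * (conj m / r))
            = (l * conj l + (-Complex.I ^ 2) * (conj c / ‖c‖ * (c / ‖c‖)) * (m * conj m)) / r ^ 2 := by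
          ring
        rw [this, hcc, Complex.I_sq, hrc, neg_neg, one_mul, one_mul, ← hrc, div_self]
        exact pow_ne_zero 2 hr0)
    obtain ⟨h, hhV, hh⟩ := hV g hg f hf
    refine ⟨h, hhV, ?_⟩
    rw [bargmannCoeff_weilAction hc hg f hh, hg0, hg1]
    have e1 : conj (conj l / r) * 1 - Complex.I * (c / ‖c‖) *
        conj (Complex.I * (c / ‖c‖) * (m / r)) * 0 = (r : ℂ)⁻¹ * l := by
      simp only [map_div₀, Complex.conj_conj, Complex.conj_ofReal]
      ring
    have e2 : conj l / r * 0 - Complex.I * (conj c / ‖c‖) * (Complex.I * (c / ‖c‖) * (m / r)) * 1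
        = (r : ℂ)⁻¹ * m := by
      linear_combination (-Complex.I ^ 2 * (m / r)) * hcc - (m / r) * Complex.I_sq
    rw [e1, e2, mul_smul_homogPoly (hhom f k)]
    exact mul_ne_zero (pow_ne_zero _ (inv_ne_zero hr0)) hne
  -- For `i + j = n < k` the exponents `k + j - i` met below lie strictly between `0` and `N`, so
  -- summing over the `N`-th roots of unity annihilates them.
  set N := 2 * k + 1 with hN
  have hζ := Complex.isPrimitiveRoot_exp N (by omega)
  set ζ := Complex.exp (2 * Real.pi * Complex.I / N)
  have hζn : ‖ζ‖ = 1 := hζ.norm'_eq_one (by omega)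
  have hζc : ζ * conj ζ = 1 := by rw [Complex.mul_conj', hζn]; simp
  have hrot : ∀ j : ℕ, ∃ h ∈ V, ∀ (n : ℕ) (l m : ℂ), bargmannCoeff (Real.pi * ‖c‖) h n l m
      = bargmannCoeff (Real.pi * ‖c‖) f₁ n (conj ζ ^ j * l) (ζ ^ j * m) := by
    intro j
    obtain ⟨g, hg, hg0, hg1⟩ := exists_special_unitary (a := ζ ^ j) (b := 0) (by
      rw [map_pow, ← mul_pow, hζc]; simp)
    obtain ⟨h, hhV, hh⟩ := hV g hg f₁ hf₁
    refine ⟨h, hhV, fun n l m => ?_⟩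
    rw [bargmannCoeff_weilAction hc hg f₁ hh, hg0, hg1]
    simp
  choose h hhV hh using hrot
  -- The unnormalized projection onto the weight of `l ^ k`, a finite sum and thus in `V` without
  -- any closedness assumption.
  set f₂ : 𝓢(ℂ, ℂ) := ∑ j ∈ Finset.range N, ζ ^ (j * k) • h j with hf₂
  have hf₂V : f₂ ∈ V := Submodule.sum_mem _ fun j _ => Submodule.smul_mem _ _ (hhV j)
  have hcoef : ∀ (n : ℕ) (l m : ℂ), bargmannCoeff (Real.pi * ‖c‖) f₂ n l m =
      ∑ j ∈ Finset.range N, ζ ^ (j * k)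
        * bargmannCoeff (Real.pi * ‖c‖) f₁ n (conj ζ ^ j * l) (ζ ^ j * m) := by
    intro n l m
    have e : (f₂ : ℂ → ℂ) = fun z => ∑ j ∈ Finset.range N, ζ ^ (j * k) * h j z := by
      ext z; simp [hf₂]
    rw [e, bargmannCoeff_sum _ fun j _ => (gaussTame_schwartz hA (h j)).const_mul _]
    exact Finset.sum_congr rfl fun j _ => by rw [bargmannCoeff_const_mul, hh]
  have h0 : f₂ = 0 := by
    refine hn f₂ hf₂V fun l m => ?_
    obtain ⟨b, hb⟩ := exists_of_mem_homogPoly (hhom f₁ n)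
    simp only [hcoef, hb, Finset.mul_sum]
    rw [Finset.sum_comm]
    refine Finset.sum_eq_zero fun p hp => ?_
    rw [mem_antidiagonal] at hp
    have hexp : ζ ^ (k + p.2) * conj ζ ^ p.1 = ζ ^ (k + p.2 - p.1) := by
      have : k + p.2 = (k + p.2 - p.1) + p.1 := by omega
      conv_lhs => rw [this]
      rw [pow_add, mul_assoc, ← mul_pow, hζc, one_pow, mul_one]
    have hω1 : ζ ^ (k + p.2 - p.1) ≠ 1 :=
      hζ.pow_ne_one_of_pos_of_lt (by omega) (by omega)
    have hgeom := geom_sum_eq hω1 N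
    rw [← pow_mul, mul_comm _ N, pow_mul, hζ.pow_eq_one, one_pow, sub_self, zero_div] at hgeom
    have : ∀ j : ℕ, ζ ^ (j * k) * (b p * ((conj ζ ^ j * l) ^ p.1 * (ζ ^ j * m) ^ p.2))
        = b p * (l ^ p.1 * m ^ p.2) * (ζ ^ (k + p.2 - p.1)) ^ j := by
      intro j
      rw [← hexp]
      ring
    simp only [this]
    rw [← Finset.mul_sum, hgeom, mul_zero]
  have hk := hcoef k 1 0
  have hterm : ∀ j : ℕ, ζ ^ (j * k)
      * bargmannCoeff (Real.pi * ‖c‖) f₁ k (conj ζ ^ j * 1) (ζ ^ j * 0)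
      = bargmannCoeff (Real.pi * ‖c‖) f₁ k 1 0 := by
    intro j
    rw [mul_zero, ← mul_zero (conj ζ ^ j), mul_smul_homogPoly (hhom f₁ k), ← mul_assoc, ← pow_mul,
      ← mul_pow, hζc, one_pow, one_mul, mul_zero]
  have hz : bargmannCoeff (Real.pi * ‖c‖) (0 : 𝓢(ℂ, ℂ)) k 1 0 = 0 := bargmannCoeff_zero _ k 1 0
  rw [h0, hz] at hk
  simp only [hterm, Finset.sum_const, Finset.card_range, nsmul_eq_mul] at hk
  exact (mul_ne_zero (by exact_mod_cast (by omega : N ≠ 0)) h₁) hk.symm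

/-- Schur's lemma in kernel form: the vectors of `V` with vanishing degree `n` component form an
invariant subspace closed in `V`, hence `0` or `V`. Injectivity of the Bargmann transform rules out
that all components vanish, and the weight comparison leaves one degree. -/
theorem exists_degree {c : ℂ} (hc : c ≠ 0) {V : Submodule ℂ 𝓢(ℂ, ℂ)}
    (hV : IsIrreducibleWeilSubspace c V) :
    ∃ n : ℕ, ∀ f ∈ V, ∀ k ≠ n, ∀ l m, bargmannCoeff (Real.pi * ‖c‖) f k l m = 0 := by
  have hA : 0 < Real.pi * ‖c‖ := mul_pos Real.pi_pos (norm_pos_iff.2 hc)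
  have htame := fun f : 𝓢(ℂ, ℂ) => gaussTame_schwartz hA f
  have hdich : ∀ n : ℕ,
      (∀ f ∈ V, (∀ l m, bargmannCoeff (Real.pi * ‖c‖) f n l m = 0) → f = 0) ∨
        ∀ f ∈ V, ∀ l m, bargmannCoeff (Real.pi * ‖c‖) f n l m = 0 := by
    intro n
    let U : Submodule ℂ 𝓢(ℂ, ℂ) :=
      { carrier := {f | f ∈ V ∧ ∀ l m, bargmannCoeff (Real.pi * ‖c‖) f n l m = 0}
        zero_mem' := ⟨V.zero_mem, fun l m => bargmannCoeff_zero _ n l m⟩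
        add_mem' := fun {f g} hf hg => ⟨V.add_mem hf.1 hg.1, fun l m => by
          have := bargmannCoeff_add (htame f) (htame g) n l m
          rw [hf.2, hg.2, add_zero] at this
          exact this⟩
        smul_mem' := fun a f hf => ⟨V.smul_mem a hf.1, fun l m => by
          have := bargmannCoeff_const_mul (A := Real.pi * ‖c‖) (f := f) a n l m
          rw [hf.2, mul_zero] at this
          exact this⟩ }
    have hU : U = ⊥ ∨ U = V := by
      refine hV.irreducible U (fun f hf => hf.1) (fun g hg f hf => ?_) ?_
      · obtain ⟨h, hhV, hh⟩ := hV.invariant g hg f hf.1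
        exact ⟨h, ⟨hhV, fun l m => by rw [bargmannCoeff_weilAction hc hg f hh, hf.2]⟩, hh⟩
      · have : {v : V | (v : 𝓢(ℂ, ℂ)) ∈ U} = ⋂ (l : ℂ) (m : ℂ),
            {v : V | bargmannCoeff (Real.pi * ‖c‖) (v : 𝓢(ℂ, ℂ)) n l m = 0} := by
          ext v
          simp only [Set.mem_iInter, Set.mem_ofPred_eq]
          exact ⟨fun h => h.2, fun h => ⟨v.2, h⟩⟩
        rw [this]
        exact isClosed_iInter fun l => isClosed_iInter fun m => isClosed_eq
          ((continuous_bargmannCoeff hA n l m).comp continuous_subtype_val) continuous_const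
    rcases hU with hU | hU
    · left
      intro f hf h0
      have : f ∈ U := ⟨hf, h0⟩
      rwa [hU, Submodule.mem_bot] at this
    · right
      intro f hf
      rw [← hU] at hf
      exact hf.2
  have hnot : ¬ ∀ f ∈ V, f = 0 := fun h => hV.ne_bot ((Submodule.eq_bot_iff V).2 h)
  obtain ⟨n, hn⟩ : ∃ n : ℕ,
      ∀ f ∈ V, (∀ l m, bargmannCoeff (Real.pi * ‖c‖) f n l m = 0) → f = 0 := by
    by_contra! hcon
    apply hnot
    intro f hf
    ext z
    refine eq_zero_of_bargmann_eq_zero (htame f) (fun l m => ?_) z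
    rw [← tsum_bargmannCoeff (htame f)]
    have : ∀ n, bargmannCoeff (Real.pi * ‖c‖) f n l m = 0 := fun n =>
      (hdich n).elim (fun h => by
        obtain ⟨g, hg, hg0, hg1⟩ := hcon n
        exact absurd (h g hg hg0) hg1) fun h => h f hf l m
    simp [this]
  refine ⟨n, fun f hf k hk l m => ?_⟩
  rcases lt_or_gt_of_ne hk with hlt | hgt
  · refine (hdich k).elim (fun h => ?_) fun h => h f hf l m
    exact absurd (fun f hf => hn f hf (bargmannCoeff_eq_zero_of_lt hc hV.invariant hlt h f hf)) hnot
  · exact bargmannCoeff_eq_zero_of_lt hc hV.invariant hgt hn f hf l m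

/-- Elements of an irreducible subspace are combinations of Hermite functions
of a fixed total degree. -/
theorem exists_hermite_expansion {c : ℂ} (hc : c ≠ 0) {V : Submodule ℂ 𝓢(ℂ, ℂ)}
    (hV : IsIrreducibleWeilSubspace c V) {f : 𝓢(ℂ, ℂ)} (hf : f ∈ V) :
    ∃ (n : ℕ) (b : ℕ × ℕ → ℂ), ∀ z, f z =
      ∑ p ∈ antidiagonal n, b p * hermiteFun (Real.pi * ‖c‖) p.1 p.2 z := by
  have hA : 0 < Real.pi * ‖c‖ := mul_pos Real.pi_pos (norm_pos_iff.2 hc)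
  obtain ⟨n, hn⟩ := exists_degree hc hV
  obtain ⟨b, hb⟩ := exists_eq_sum_hermiteFun hA (gaussTame_schwartz hA f) (hn f hf)
  exact ⟨n, b, hb⟩

/-! ### The Mellin transforms of Hermite functions: algebra -/

/-- The normalized Mellin transform of a complex Hermite function. -/
def hermiteMellin : ℕ → ℕ → ℂ → ℂ
  | 0, j, s => Complex.Gamma (s + j / 2)
  | k + 1, j, s => hermiteMellin k j (s + 1 / 2) - j / 2 * hermiteMellin k (j - 1) s

/-- The definition recurses in the first index only. This is the mirror recursion in the second,
from which the symmetry in `k` and `j` follows. -/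
theorem hermiteMellin_succ_right (k j : ℕ) (s : ℂ) :
    hermiteMellin k (j + 1) s = hermiteMellin k j (s + 1 / 2)
      - k / 2 * hermiteMellin (k - 1) j s := by
  induction k generalizing j s with
  | zero =>
    simp only [hermiteMellin]
    push_cast
    rw [zero_div, zero_mul, sub_zero]
    congr 1
    ring
  | succ k ih =>
    have h1 : (k : ℂ) * hermiteMellin k j s = k * (hermiteMellin (k - 1) j (s + 1 / 2)
        - j / 2 * hermiteMellin (k - 1) (j - 1) s) := by
      rcases k with _ | k
      · simp
      · rfl
    have h2 : (j : ℂ) * hermiteMellin k j s = j * (hermiteMellin k (j - 1) (s + 1 / 2)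
        - k / 2 * hermiteMellin (k - 1) (j - 1) s) := by
      rcases j with _ | j
      · simp
      · rw [ih]; rfl
    simp only [hermiteMellin, Nat.add_sub_cancel, ih]
    push_cast
    linear_combination (1 / 2 : ℂ) * h1 - (1 / 2 : ℂ) * h2

theorem hermiteMellin_comm (k j : ℕ) (s : ℂ) : hermiteMellin k j s = hermiteMellin j k s := by
  induction k generalizing j s with
  | zero =>
    induction j generalizing s with
    | zero => rfl
    | succ j ih =>
      rw [hermiteMellin_succ_right, ih]
      show _ = hermiteMellin j 0 (s + 1 / 2) - ((0 : ℕ) : ℂ) / 2 * hermiteMellin j (0 - 1) s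
      simp
  | succ k ih => rw [hermiteMellin_succ_right, hermiteMellin, ih, ih]

/-- The functional equation `Γ(x + 1) = x Γ(x)`, propagated through the recursion. Positivity of
`s.re` keeps `x = s + j/2` nonzero in the base case. -/
theorem hermiteMellin_add_one (k j : ℕ) {s : ℂ} (hs : 0 < s.re) :
    2 * hermiteMellin k j (s + 1) = 2 * s * hermiteMellin k j s
      + k * hermiteMellin (k - 1) j (s + 1 / 2) + j * hermiteMellin k (j - 1) (s + 1 / 2) := by
  induction k generalizing j s with
  | zero =>
    have hne : s + j / 2 ≠ 0 := by
      intro h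
      have := congrArg Complex.re h
      simp at this
      have hj : (0 : ℝ) ≤ j / 2 := by positivity
      linarith
    have h1 : hermiteMellin 0 j (s + 1) = (s + j / 2) * hermiteMellin 0 j s := by
      simp only [hermiteMellin]
      rw [← Complex.Gamma_add_one _ hne]
      congr 1; ring
    have h2 : (j : ℂ) * hermiteMellin 0 (j - 1) (s + 1 / 2) = j * hermiteMellin 0 j s := by
      rcases j with _ | j
      · simp
      · simp only [hermiteMellin, Nat.add_sub_cancel]
        congr 2
        push_cast
        ring
    rw [h1, h2]
    push_cast
    ring
  | succ k ih =>
    have hs2 : 0 < (s + 1 / 2).re := by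
      have : (s + 1 / 2).re = s.re + 1 / 2 := by simp
      linarith
    have e1 := ih j hs2
    have e2 : (j : ℂ) * (2 * hermiteMellin k (j - 1) (s + 1)) =
        j * (2 * s * hermiteMellin k (j - 1) s
          + k * hermiteMellin (k - 1) (j - 1) (s + 1 / 2)
          + (j - 1 : ℕ) * hermiteMellin k (j - 1 - 1) (s + 1 / 2)) := by rw [ih _ hs]
    have h1 : (k : ℂ) * hermiteMellin k j (s + 1 / 2) =
        k * (hermiteMellin (k - 1) j (s + 1 / 2 + 1 / 2)
        - j / 2 * hermiteMellin (k - 1) (j - 1) (s + 1 / 2)) := by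
      rcases k with _ | k
      · simp
      · rfl
    have a1 : s + 1 / 2 + 1 = s + 1 + 1 / 2 := by ring
    have a2 : s + 1 / 2 + 1 / 2 = s + 1 := by ring
    rw [a1, a2] at e1
    rw [a2] at h1
    simp only [hermiteMellin, Nat.add_sub_cancel, a2]
    push_cast
    linear_combination e1 - (1 / 2 : ℂ) * e2 - h1

/-- Eliminating the values at `s + 1/2` and `s + 1` leaves a recurrence at fixed `s` along the
diagonal `k - j = const`; it is the three-term recurrence of `mellinPoly`. -/
theorem hermiteMellin_succ_succ (k j : ℕ) {s : ℂ} (hs : 0 < s.re) :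
    hermiteMellin (k + 1) (j + 1) s = (s - 1 / 2) * hermiteMellin k j s
      + k * j / 4 * hermiteMellin (k - 1) (j - 1) s := by
  have h3 := hermiteMellin_add_one k j hs
  have h2 : (j : ℂ) * hermiteMellin k j s = j * (hermiteMellin k (j - 1) (s + 1 / 2)
      - k / 2 * hermiteMellin (k - 1) (j - 1) s) := by
    rcases j with _ | j
    · simp
    · rw [hermiteMellin_succ_right]; rfl
  have a2 : s + 1 / 2 + 1 / 2 = s + 1 := by ring
  simp only [hermiteMellin, Nat.add_sub_cancel, hermiteMellin_succ_right k j (s + 1 / 2), a2]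
  push_cast
  linear_combination (1 / 2 : ℂ) * h3 - (1 / 2 : ℂ) * h2

/-- The polynomial factor of the Mellin transform of a Hermite function. -/
def mellinPoly (a : ℕ) : ℕ → ℂ → ℂ
  | 0, _ => 1
  | 1, s => s - 1 / 2
  | l + 2, s => (s - 1 / 2) * mellinPoly a (l + 1) s
      + (l + 1) * (l + 1 + a) / 4 * mellinPoly a l s

theorem hermiteMellin_eq_Gamma_mul (a l : ℕ) {s : ℂ} (hs : 0 < s.re) :
    hermiteMellin (l + a) l s = Complex.Gamma (s + a / 2) * mellinPoly a l s := by
  have h0 : hermiteMellin a 0 s = Complex.Gamma (s + a / 2) := by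
    rw [hermiteMellin_comm]; rfl
  induction l using Nat.strong_induction_on with
  | _ l ih =>
    match l with
    | 0 => simp [h0, mellinPoly]
    | 1 =>
      rw [add_comm 1 a, hermiteMellin_succ_succ a 0 hs, h0, mellinPoly]
      push_cast
      ring
    | l + 2 =>
      have e : l + 2 + a = (l + 1 + a) + 1 := by ring
      have e2 : l + 1 + a - 1 = l + a := by omega
      rw [e, hermiteMellin_succ_succ _ _ hs, ih (l + 1) (by omega), Nat.add_sub_cancel, e2,
        ih l (by omega), mellinPoly]
      push_cast
      ring

theorem differentiable_mellinPoly (a l : ℕ) : Differentiable ℂ (mellinPoly a l) := by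
  induction l using Nat.strong_induction_on with
  | _ l ih =>
    match l with
    | 0 => exact differentiable_const _
    | 1 => exact differentiable_id.sub_const _
    | l + 2 =>
      have h1 := ih (l + 1) (by omega)
      have h2 := ih l (by omega)
      show Differentiable ℂ fun s => (s - 1 / 2) * mellinPoly a (l + 1) s
        + (l + 1) * (l + 1 + a) / 4 * mellinPoly a l s
      fun_prop

/-- Off the critical line, consecutive polynomials have a ratio in an open half plane. -/
theorem mellinPoly_ratio (a l : ℕ) {s : ℂ} (hs : s.re ≠ 1 / 2) :
    mellinPoly a l s ≠ 0 ∧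
      0 < (s.re - 1 / 2) * (mellinPoly a (l + 1) s * conj (mellinPoly a l s)).re := by
  have hδ : 0 < (s.re - 1 / 2) ^ 2 := by
    have := sub_ne_zero.2 hs
    positivity
  have hre : (s - 1 / 2).re = s.re - 1 / 2 := by simp
  induction l with
  | zero =>
    refine ⟨one_ne_zero, ?_⟩
    simp only [mellinPoly, map_one, mul_one, hre]
    linarith
  | succ l ih =>
    have hne : mellinPoly a (l + 1) s ≠ 0 := by
      intro h
      have := ih.2
      rw [h] at this
      simp at this
    refine ⟨hne, ?_⟩
    -- Divided by `‖p_{l+1}‖²`, this says that the new ratio is `s - 1/2` plus a positive multiple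
    -- of the inverse of the old one. Inversion preserves the right and left half planes, so both
    -- terms lie on the same side.
    have e : mellinPoly a (l + 1 + 1) s * conj (mellinPoly a (l + 1) s) =
        ((‖mellinPoly a (l + 1) s‖ ^ 2 : ℝ) : ℂ) * (s - 1 / 2)
        + (((l + 1) * (l + 1 + a) / 4 : ℝ) : ℂ)
          * conj (mellinPoly a (l + 1) s * conj (mellinPoly a l s)) := by
      push_cast
      rw [← Complex.mul_conj', map_mul, Complex.conj_conj]
      show ((s - 1 / 2) * mellinPoly a (l + 1) s
        + (l + 1) * (l + 1 + a) / 4 * mellinPoly a l s) * conj (mellinPoly a (l + 1) s) = _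
      ring
    rw [e, Complex.add_re, Complex.re_ofReal_mul, Complex.re_ofReal_mul, Complex.conj_re, hre,
      mul_add]
    have h1 : 0 < ‖mellinPoly a (l + 1) s‖ ^ 2 := by positivity
    have h2 : (0 : ℝ) < (l + 1) * (l + 1 + a) / 4 := by positivity
    have h3 := mul_pos h1 hδ
    have h4 := mul_pos h2 ih.2
    linarith

theorem re_eq_half_of_mellinPoly_eq_zero {a l : ℕ} {s : ℂ} (h : mellinPoly a l s = 0) :
    s.re = 1 / 2 := by
  by_contra hs
  exact (mellinPoly_ratio a l hs).1 h

/-! ### Mellin transforms of Hermite functions: analysis -/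

theorem HasMellin.ofReal_mul {f : ℝ → ℂ} {s m : ℂ} (h : HasMellin f (s + 1) m) :
    HasMellin (fun t => (t : ℂ) * f t) s m := by
  have e : (fun t : ℝ => (t : ℂ) * f t) = fun t : ℝ => (t : ℂ) ^ (1 : ℂ) • f t := by
    ext t; rw [Complex.cpow_one, smul_eq_mul]
  rw [e]
  exact ⟨MellinConvergent.cpow_smul.2 h.1, by rw [mellin_cpow_smul, h.2]⟩

/-- The substitution `r ↦ r²` turns the Mellin transform of the Gaussian into `Γ`, whence the
argument `2 * s`. Multiplication by `r` then shifts `s` by `1/2`, which is the recursion of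
`hermiteMellin`. -/
theorem hasMellin_hermiteFun {A : ℝ} (hA : 0 < A) (k j : ℕ) {s : ℂ} (hs : 0 < s.re) :
    HasMellin (fun r : ℝ => hermiteFun A k j r) (2 * s)
      ((A : ℂ) ^ (-(s + (k + j) / 2)) / 2 * hermiteMellin k j s) := by
  have hA' : (A : ℂ) ≠ 0 := by exact_mod_cast hA.ne'
  have hhalf : ∀ {s : ℂ}, 0 < s.re → 0 < (s + 1 / 2).re := by
    intro s hs
    have : (s + 1 / 2).re = s.re + 1 / 2 := by simp
    linarith
  induction k generalizing j s with
  | zero =>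
    induction j generalizing s with
    | zero =>
      have e : (fun r : ℝ => hermiteFun A 0 0 r)
          = fun r : ℝ => (fun t : ℝ => (Real.exp (-(A * t)) : ℂ)) (r ^ (2 : ℝ)) := by
        ext r
        simp only [hermiteFun, complexHermite, pow_zero, one_mul]
        rw [Complex.norm_real, ← Complex.ofReal_pow, Real.norm_eq_abs, sq_abs]
        push_cast
        rw [neg_mul]
        congr 3
        rw [Real.rpow_two]
        push_cast
        rfl
      have h2 : 2 * s / ((2 : ℝ) : ℂ) = s := by push_cast; field_simp
      have hconv : MellinConvergent (fun t : ℝ => (Real.exp (-t) : ℂ)) s := by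
        have := Complex.GammaIntegral_convergent hs
        refine this.congr_fun (fun t _ => ?_) measurableSet_Ioi
        simp only [smul_eq_mul]
        ring
      rw [e]
      refine ⟨?_, ?_⟩
      · rw [MellinConvergent.comp_rpow (f := fun t : ℝ => (Real.exp (-(A * t)) : ℂ)) two_ne_zero, h2]
        exact (MellinConvergent.comp_mul_left (f := fun t : ℝ => (Real.exp (-t) : ℂ)) hA).2 hconv
      · rw [mellin_comp_rpow (fun t : ℝ => (Real.exp (-(A * t)) : ℂ)), h2,
          mellin_comp_mul_left (fun t : ℝ => (Real.exp (-t) : ℂ)) s hA,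
          ← Complex.GammaIntegral_eq_mellin, ← Complex.Gamma_eq_integral hs]
        simp only [hermiteMellin, Nat.cast_zero, zero_div, add_zero, smul_eq_mul,
          Complex.real_smul]
        norm_num
        ring
    | succ j ih =>
      have h := ih (hhalf hs)
      have e : (fun r : ℝ => hermiteFun A 0 (j + 1) r)
          = fun r : ℝ => (r : ℂ) * hermiteFun A 0 j r := by
        ext r
        rw [hermiteFun_zero_succ]
        show conj (r : ℂ) * _ = _
        rw [Complex.conj_ofReal]
      rw [e]
      refine HasMellin.ofReal_mul ?_
      convert h using 1
      · ring
      · have a1 : s + ((0 : ℕ) + (j + 1 : ℕ) : ℂ) / 2 = s + 1 / 2 + ((0 : ℕ) + j) / 2 := by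
          push_cast; ring
        have a2 : s + 1 / 2 + (j : ℂ) / 2 = s + (j + 1 : ℕ) / 2 := by
          push_cast; ring
        simp only [hermiteMellin]
        rw [a1, a2]
  | succ k ih =>
    have e : (fun r : ℝ => hermiteFun A (k + 1) j r)
        = fun r : ℝ => (r : ℂ) * hermiteFun A k j r
          - (j / (2 * A) : ℂ) • hermiteFun A k (j - 1) r := by
      ext r; rw [hermiteFun_succ]; rfl
    have h1 : HasMellin (fun r : ℝ => (r : ℂ) * hermiteFun A k j r) (2 * s)
        ((A : ℂ) ^ (-(s + 1 / 2 + (k + j) / 2)) / 2 * hermiteMellin k j (s + 1 / 2)) := by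
      refine HasMellin.ofReal_mul ?_
      convert ih j (hhalf hs) using 1
      ring
    have h2 := hasMellin_const_smul (ih (j - 1) hs).1 (j / (2 * A) : ℂ)
    have h3 := hasMellin_sub h1.1 h2.1
    rw [h1.2, h2.2, (ih (j - 1) hs).2] at h3
    rw [e]
    convert h3 using 1
    have ee : (j : ℂ) * (A : ℂ) ^ (-(s + (k + (j - 1 : ℕ)) / 2))
        = j * ((A : ℂ) ^ (-(s + (k + 1 + j) / 2)) * A) := by
      rcases j with _ | j
      · simp
      · nth_rewrite 3 [← Complex.cpow_one (A : ℂ)]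
        rw [← Complex.cpow_add _ _ hA', Nat.add_sub_cancel]
        congr 2
        push_cast
        ring
    have e1 : s + 1 / 2 + (k + j : ℂ) / 2 = s + (k + 1 + j) / 2 := by ring
    rw [e1, smul_eq_mul]
    simp only [hermiteMellin]
    push_cast
    have : (j / (2 * A) : ℂ) * ((A : ℂ) ^ (-(s + (k + (j - 1 : ℕ)) / 2)) / 2
        * hermiteMellin k (j - 1) s) = ((j : ℂ) * (A : ℂ) ^ (-(s + (k + (j - 1 : ℕ)) / 2)))
          * hermiteMellin k (j - 1) s / (4 * A) := by
      field_simp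
      ring
    rw [this, ee]
    field_simp
    ring

/-- Both terms of the Hermite recursion have the same rotation weight: lowering `j` by one matches
multiplying by `z` because `u * conj u = 1`. -/
theorem hermiteFun_mul_circle (A : ℝ) (k j : ℕ) (r : ℝ) {u : ℂ} (hu : ‖u‖ = 1) :
    hermiteFun A k j (r * u) = u ^ k * conj u ^ j * hermiteFun A k j r := by
  have huu : u * conj u = 1 := by rw [Complex.mul_conj', hu]; simp
  have h : complexHermite A k j (r * u) = u ^ k * conj u ^ j * complexHermite A k j r := by
    induction k generalizing j with
    | zero => simp only [complexHermite, map_mul]; ring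
    | succ k ih =>
      simp only [complexHermite, ih]
      rcases j with _ | j
      · simp; ring
      · rw [Nat.add_sub_cancel]
        linear_combination (((j + 1 : ℕ) : ℂ) / (2 * A) * u ^ k * conj u ^ j
          * complexHermite A k j r) * huu
  rw [hermiteFun, h, norm_mul, hu, mul_one, hermiteFun, mul_assoc]

/-! ### Unitary characters -/

/-- Integrating the functional equation writes `ψ` as a multiple of a difference of its primitive,
so `ψ` is differentiable and solves `ψ' = κ ψ`. The unit norm forces `κ` to be imaginary. -/
theorem exists_eq_cexp_of_continuous_hom {ψ : ℝ → ℂ} (hc : Continuous ψ)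
    (hadd : ∀ x y, ψ (x + y) = ψ x * ψ y) (hn : ∀ x, ‖ψ x‖ = 1) :
    ∃ t : ℝ, ∀ x, ψ x = Complex.exp (Complex.I * t * x) := by
  have h0 : ψ 0 = 1 := by
    have h := hadd 0 0
    rw [add_zero] at h
    have hne : ψ 0 ≠ 0 := fun h => by simpa [h] using hn 0
    exact (mul_eq_left₀ hne).1 h.symm
  set Ψ : ℝ → ℂ := fun x => ∫ t in (0 : ℝ)..x, ψ t with hΨ
  have hΨd : ∀ x, HasDerivAt Ψ (ψ x) x := fun x =>
    intervalIntegral.integral_hasDerivAt_right (hc.intervalIntegrable _ _)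
      hc.aestronglyMeasurable.stronglyMeasurableAtFilter hc.continuousAt
  obtain ⟨δ, hδ⟩ : ∃ δ, Ψ δ ≠ 0 := by
    by_contra! h
    have h1 := hΨd 0
    have h2 : Ψ = fun _ => 0 := funext h
    rw [h2] at h1
    have := h1.unique (hasDerivAt_const 0 0)
    rw [h0] at this
    exact one_ne_zero this
  have hshift : ∀ x, ψ x * Ψ δ = Ψ (x + δ) - Ψ x := by
    intro x
    rw [hΨ]
    simp only
    rw [intervalIntegral.integral_interval_sub_left (hc.intervalIntegrable _ _)
      (hc.intervalIntegrable _ _), ← intervalIntegral.integral_const_mul]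
    simp only [← hadd]
    rw [intervalIntegral.integral_comp_add_left (fun t => ψ t) x, add_zero]
  set κ : ℂ := (ψ δ - 1) / Ψ δ with hκ
  have hd : ∀ x, HasDerivAt ψ (κ * ψ x) x := by
    intro x
    have e : ψ = fun x => (Ψ (x + δ) - Ψ x) / Ψ δ := by
      ext x; rw [← hshift, mul_div_cancel_right₀ _ hδ]
    have h1 : HasDerivAt (fun x => (Ψ (x + δ) - Ψ x) / Ψ δ) ((ψ (x + δ) - ψ x) / Ψ δ) x :=
      (((hΨd (x + δ)).comp_add_const x δ).sub (hΨd x)).div_const _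
    rw [← e] at h1
    refine h1.congr_deriv ?_
    rw [hadd, hκ]
    field_simp
  have hexp : ∀ x : ℝ, ψ x = Complex.exp (κ * x) := by
    have hconst : ∀ x : ℝ, HasDerivAt (fun x : ℝ => ψ x * Complex.exp (-κ * x)) 0 x := by
      intro x
      have h1 : HasDerivAt (fun x : ℝ => -κ * (x : ℂ)) (-κ) x := by
        simpa using ((hasDerivAt_id x).ofReal_comp).const_mul (-κ)
      refine ((hd x).fun_mul h1.cexp).congr_deriv ?_
      ring
    intro x
    have := is_const_of_deriv_eq_zero (fun y => (hconst y).differentiableAt)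
      (fun y => (hconst y).deriv) x 0
    simp only [h0, Complex.ofReal_zero, mul_zero, Complex.exp_zero, mul_one] at this
    rw [← mul_one (ψ x), ← Complex.exp_zero, ← neg_add_cancel (κ * (x : ℂ)), Complex.exp_add,
      ← mul_assoc, ← neg_mul, this, one_mul]
  have hre : κ.re = 0 := by
    have h1 := hn 1
    rw [hexp, Complex.norm_exp] at h1
    simpa using h1
  refine ⟨κ.im, fun x => ?_⟩
  rw [hexp]
  congr 2
  apply Complex.ext <;> simp [hre]

theorem continuousOn_mulCharExt (ν : ℂˣ →ₜ* Circle) : ContinuousOn (mulCharExt ν) {0}ᶜ := by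
  rw [continuousOn_iff_continuous_domRestrict]
  have e : ({0}ᶜ : Set ℂ).domRestrict (mulCharExt ν)
      = fun z => ((ν (unitsHomeomorphNeZero.symm ⟨z.1, fun h => z.2 h⟩) : Circle) : ℂ) := by
    ext z
    have hz : (z : ℂ) ≠ 0 := fun h => z.2 h
    rw [Set.domRestrict_apply, mulCharExt, dif_neg hz]
    congr 2
    exact ((unitsHomeomorphNeZero (G₀ := ℂ)).symm_apply_eq.2 rfl).symm
  rw [e]
  have hcoe : Continuous ((↑) : Circle → ℂ) := continuous_subtype_val
  exact hcoe.comp ((map_continuous ν).comp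
    (unitsHomeomorphNeZero.symm.continuous.comp (by fun_prop)))

theorem mulCharExt_mul (ν : ℂˣ →ₜ* Circle) {z w : ℂ} (hz : z ≠ 0) (hw : w ≠ 0) :
    mulCharExt ν (z * w) = mulCharExt ν z * mulCharExt ν w := by
  rw [mulCharExt, mulCharExt, mulCharExt, dif_neg hz, dif_neg hw, dif_neg (mul_ne_zero hz hw),
    Units.mk0_mul, map_mul, Circle.coe_mul]

theorem norm_mulCharExt (ν : ℂˣ →ₜ* Circle) {z : ℂ} (hz : z ≠ 0) : ‖mulCharExt ν z‖ = 1 := by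
  rw [mulCharExt, dif_neg hz, Circle.norm_coe]

theorem exists_mulCharExt_comp_cexp (ν : ℂˣ →ₜ* Circle) (a : ℂ) :
    ∃ t : ℝ, ∀ x : ℝ, mulCharExt ν (Complex.exp (a * x)) = Complex.exp (Complex.I * t * x) := by
  apply exists_eq_cexp_of_continuous_hom
  · exact (continuousOn_mulCharExt ν).comp_continuous (by fun_prop)
      fun x => Complex.exp_ne_zero _
  · intro x y
    push_cast
    rw [mul_add, Complex.exp_add, mulCharExt_mul ν (Complex.exp_ne_zero _) (Complex.exp_ne_zero _)]
  · exact fun x => norm_mulCharExt ν (Complex.exp_ne_zero _)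

/-- Unitary characters of `ℂˣ` in polar coordinates. -/
theorem exists_mulCharExt_polar (ν : ℂˣ →ₜ* Circle) :
    ∃ (t : ℝ) (w : ℤ), ∀ r : ℝ, 0 < r → ∀ θ : ℝ,
      mulCharExt ν (r * Complex.exp (θ * Complex.I))
        = (r : ℂ) ^ (Complex.I * t) * Complex.exp (w * θ * Complex.I) := by
  obtain ⟨t, ht⟩ := exists_mulCharExt_comp_cexp ν 1
  obtain ⟨b, hb⟩ := exists_mulCharExt_comp_cexp ν Complex.I
  obtain ⟨w, hw⟩ : ∃ w : ℤ, b = w := by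
    have h0 := hb 0
    have h := hb (2 * Real.pi)
    have e : Complex.exp (Complex.I * ((2 * Real.pi : ℝ) : ℂ)) = 1 := by
      rw [mul_comm]; push_cast; exact Complex.exp_two_pi_mul_I
    simp only [Complex.ofReal_zero, mul_zero, Complex.exp_zero] at h0
    rw [e, h0, eq_comm, Complex.exp_eq_one_iff] at h
    obtain ⟨w, hw⟩ := h
    refine ⟨w, ?_⟩
    have hpi : (2 * Real.pi * Complex.I : ℂ) ≠ 0 := Complex.two_pi_I_ne_zero
    have : (b : ℂ) = w := by
      apply mul_right_cancel₀ hpi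
      rw [← hw]
      push_cast
      ring
    exact_mod_cast this
  refine ⟨t, w, fun r hr θ => ?_⟩
  have hr' : (r : ℂ) ≠ 0 := by exact_mod_cast hr.ne'
  rw [mulCharExt_mul ν hr' (Complex.exp_ne_zero _), mul_comm (θ : ℂ), hb, hw]
  have h1 := ht (Real.log r)
  rw [one_mul, ← Complex.ofReal_exp, Real.exp_log hr] at h1
  rw [h1, Complex.cpow_def_of_ne_zero hr', ← Complex.ofReal_log hr.le]
  congr 2
  · ring
  · push_cast; ring

/-! ### Tate integrals of Hermite functions -/

theorem norm_hermiteFun_norm (A : ℝ) (k j : ℕ) {z : ℂ} (hz : z ≠ 0) :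
    ‖hermiteFun A k j z‖ = ‖hermiteFun A k j (‖z‖ : ℂ)‖ := by
  have hn : (‖z‖ : ℂ) ≠ 0 := by exact_mod_cast norm_ne_zero_iff.2 hz
  have hu : ‖z / ‖z‖‖ = 1 := by
    rw [norm_div, Complex.norm_real, norm_norm, div_self (norm_ne_zero_iff.2 hz)]
  have h := hermiteFun_mul_circle A k j ‖z‖ hu
  rw [mul_div_cancel₀ _ hn] at h
  rw [h, norm_mul, norm_mul, norm_pow, norm_pow, RCLike.norm_conj, hu]
  simp

theorem integrableOn_hermite_tate {A : ℝ} (hA : 0 < A) (k j : ℕ) (ν : ℂˣ →ₜ* Circle) {s : ℂ}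
    (hs : 0 < s.re) :
    IntegrableOn (fun z : ℂ => hermiteFun A k j z * mulCharExt ν z * (‖z‖ : ℂ) ^ (2 * s - 2))
      {0}ᶜ := by
  have hrad : Integrable fun z : ℂ => (fun r : ℝ =>
      ‖hermiteFun A k j r‖ * ‖(r : ℂ) ^ (2 * s - 2)‖) ‖z‖ := by
    rw [integrable_fun_norm_addHaar (volume : Measure ℂ)
      (f := fun r : ℝ => ‖hermiteFun A k j r‖ * ‖(r : ℂ) ^ (2 * s - 2)‖)]
    have h : IntegrableOn _ (Set.Ioi (0 : ℝ)) := (hasMellin_hermiteFun hA k j hs).1.norm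
    refine h.congr_fun (fun r hr => ?_) measurableSet_Ioi
    have hr0 : (r : ℂ) ≠ 0 := by exact_mod_cast (ne_of_gt hr : r ≠ 0)
    have e : (2 * s - 1 : ℂ) = 1 + (2 * s - 2) := by ring
    simp only [Complex.finrank_real_complex, smul_eq_mul, norm_mul]
    rw [e, Complex.cpow_add _ _ hr0, Complex.cpow_one, norm_mul, Complex.norm_real,
      Real.norm_of_nonneg (le_of_lt hr)]
    norm_num
    ring
  refine hrad.integrableOn.mono' ?_ ?_
  · refine ContinuousOn.aestronglyMeasurable ?_ (measurableSet_singleton 0).compl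
    refine ((gaussTame_hermiteFun hA k j).continuous.continuousOn.mul
      (continuousOn_mulCharExt ν)).mul ?_
    refine ContinuousOn.cpow (by fun_prop) continuousOn_const fun z hz => ?_
    rw [Complex.ofReal_mem_slitPlane]
    exact norm_pos_iff.2 hz
  · refine (ae_restrict_iff' (measurableSet_singleton 0).compl).2
      (Filter.Eventually.of_forall fun z hz => ?_)
    rw [norm_mul, norm_mul, norm_mulCharExt ν hz, mul_one, norm_hermiteFun_norm A k j hz]

theorem integral_cexp_int_mul (n : ℤ) :
    ∫ θ in Set.Ioo (-Real.pi) Real.pi, Complex.exp (n * θ * Complex.I)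
      = if n = 0 then 2 * (Real.pi : ℂ) else 0 := by
  rw [← integral_Ioc_eq_integral_Ioo, ← intervalIntegral.integral_of_le
    (by linarith [Real.pi_pos])]
  split_ifs with h
  · simp only [h, Int.cast_zero, zero_mul, Complex.exp_zero]
    rw [intervalIntegral.integral_const]
    simp
    ring
  · have hn : (n * Complex.I : ℂ) ≠ 0 :=
      mul_ne_zero (by exact_mod_cast h) Complex.I_ne_zero
    have e : ∀ θ : ℝ, Complex.exp (n * θ * Complex.I) = Complex.exp ((n * Complex.I) * θ) := by
      intro θ; congr 1; ring
    simp only [e]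
    rw [integral_exp_mul_complex hn, div_eq_zero_iff]
    left
    rw [sub_eq_zero, Complex.exp_eq_exp_iff_exists_int]
    refine ⟨n, ?_⟩
    push_cast
    ring

/-- In polar coordinates the integrand separates. The radial part of `ν` shifts `s` by `I * t / 2`,
and the angular integral is orthogonality of the characters of the circle. -/
theorem integral_hermite_tate (A : ℝ) (k j : ℕ) {ν : ℂˣ →ₜ* Circle}
    {t : ℝ} {w : ℤ} (hν : ∀ r : ℝ, 0 < r → ∀ θ : ℝ, mulCharExt ν (r * Complex.exp (θ * Complex.I))
        = (r : ℂ) ^ (Complex.I * t) * Complex.exp (w * θ * Complex.I)) (s : ℂ) :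
    ∫ z in ({0}ᶜ : Set ℂ), hermiteFun A k j z * mulCharExt ν z * (‖z‖ : ℂ) ^ (2 * s - 2)
      = mellin (fun r : ℝ => hermiteFun A k j r) (2 * (s + Complex.I * t / 2))
        * if (k : ℤ) - j + w = 0 then 2 * (Real.pi : ℂ) else 0 := by
  rw [setIntegral_eq_integral_of_forall_compl_eq_zero (fun z hz => by
      rw [Set.mem_compl_iff, not_not, Set.mem_singleton_iff] at hz
      simp [hz, mulCharExt]),
    ← Complex.integral_comp_polarCoord_symm, ← integral_cexp_int_mul, mellin,
    ← setIntegral_prod_mul, ← Measure.volume_eq_prod]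
  refine setIntegral_congr_fun polarCoord.open_target.measurableSet fun p hp => ?_
  obtain ⟨r, θ⟩ := p
  have hr : 0 < r := hp.1
  have hr0 : (r : ℂ) ≠ 0 := by exact_mod_cast hr.ne'
  have hz : (Complex.polarCoord.symm (r, θ) : ℂ) = r * Complex.exp (θ * Complex.I) := by
    rw [Complex.polarCoord_symm_apply, Complex.exp_mul_I, Complex.ofReal_cos, Complex.ofReal_sin]
  simp only
  rw [hz, hν r hr θ, hermiteFun_mul_circle A k j r (Complex.norm_exp_ofReal_mul_I θ), norm_mul,
    Complex.norm_exp_ofReal_mul_I, mul_one, Complex.norm_real, Real.norm_of_nonneg hr.le,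
    ← Complex.exp_conj, map_mul, Complex.conj_ofReal, Complex.conj_I, ← Complex.exp_nat_mul,
    ← Complex.exp_nat_mul, ← Complex.exp_add, Complex.real_smul, smul_eq_mul]
  have e1 : (2 * (s + Complex.I * t / 2) - 1 : ℂ) = 1 + (Complex.I * t + (2 * s - 2)) := by ring
  have e2 : ((((k : ℤ) - j + w : ℤ) : ℂ) * θ * Complex.I)
      = (k * (θ * Complex.I) + j * (θ * -Complex.I)) + w * θ * Complex.I := by
    push_cast; ring
  rw [e1, e2, Complex.cpow_add _ _ hr0, Complex.cpow_add _ _ hr0, Complex.cpow_one,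
    Complex.exp_add (k * (θ * Complex.I) + j * (θ * -Complex.I))]
  ring

theorem tateIntegrand_eq_sum {A : ℝ} {n : ℕ} {b : ℕ × ℕ → ℂ} {f : 𝓢(ℂ, ℂ)}
    (hf : ∀ z, f z = ∑ p ∈ antidiagonal n, b p * hermiteFun A p.1 p.2 z)
    (ν : ℂˣ →ₜ* Circle) (s : ℂ) :
    tateIntegrand ν f s = fun z => ∑ p ∈ antidiagonal n,
      b p * (hermiteFun A p.1 p.2 z * mulCharExt ν z * (‖z‖ : ℂ) ^ (2 * s - 2)) := by
  ext z
  rw [tateIntegrand, hf, Finset.sum_mul, Finset.sum_mul]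
  exact Finset.sum_congr rfl fun p _ => by ring

theorem integrableOn_tateIntegrand {A : ℝ} (hA : 0 < A) {n : ℕ} {b : ℕ × ℕ → ℂ} {f : 𝓢(ℂ, ℂ)}
    (hf : ∀ z, f z = ∑ p ∈ antidiagonal n, b p * hermiteFun A p.1 p.2 z)
    (ν : ℂˣ →ₜ* Circle) {s : ℂ} (hs : 0 < s.re) :
    IntegrableOn (tateIntegrand ν f s) {0}ᶜ := by
  rw [tateIntegrand_eq_sum hf]
  exact integrable_finsetSum _ fun p _ => (integrableOn_hermite_tate hA p.1 p.2 ν hs).const_mul _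

/-- The Tate integral of a combination of Hermite functions of a fixed degree. -/
theorem exists_integral_tateIntegrand_eq {A : ℝ} (hA : 0 < A) {n : ℕ} {b : ℕ × ℕ → ℂ}
    {f : 𝓢(ℂ, ℂ)} (hf : ∀ z, f z = ∑ p ∈ antidiagonal n, b p * hermiteFun A p.1 p.2 z)
    (ν : ℂˣ →ₜ* Circle) :
    ∃ (C : ℂ) (t : ℝ) (a l : ℕ), ∀ s : ℂ, 0 < s.re →
      ∫ z in ({0}ᶜ : Set ℂ), tateIntegrand ν f s z =
        C * (A : ℂ) ^ (-(s + Complex.I * t / 2 + n / 2))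
          * mellinPoly a l (s + Complex.I * t / 2)
          * Complex.Gamma (s + Complex.I * t / 2 + a / 2) := by
  obtain ⟨t, w, hν⟩ := exists_mulCharExt_polar ν
  have hre : ∀ s : ℂ, (s + Complex.I * t / 2).re = s.re := by
    intro s
    have : Complex.I * t / 2 = ((t / 2 : ℝ) : ℂ) * Complex.I := by push_cast; ring
    rw [this]
    simp
  have hsum : ∀ s : ℂ, 0 < s.re → ∫ z in ({0}ᶜ : Set ℂ), tateIntegrand ν f s z =
      ∑ p ∈ antidiagonal n, b p *
        ((A : ℂ) ^ (-(s + Complex.I * t / 2 + n / 2)) / 2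
          * hermiteMellin p.1 p.2 (s + Complex.I * t / 2)
          * if (p.1 : ℤ) - p.2 + w = 0 then 2 * (Real.pi : ℂ) else 0) := by
    intro s hs
    rw [tateIntegrand_eq_sum hf, integral_finsetSum _ fun p _ =>
      (integrableOn_hermite_tate hA p.1 p.2 ν hs).const_mul _]
    refine Finset.sum_congr rfl fun p hp => ?_
    rw [integral_const_mul, integral_hermite_tate A p.1 p.2 hν,
      (hasMellin_hermiteFun hA p.1 p.2 (by rwa [hre])).2]
    have : (p.1 : ℂ) + p.2 = n := by exact_mod_cast mem_antidiagonal.1 hp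
    rw [this]
  -- On the antidiagonal, `k + j = n` and `k - j = -w` determine at most one pair; if there is none,
  -- the integral vanishes identically and `C = 0` serves.
  by_cases h : ∃ p ∈ antidiagonal n, (p.1 : ℤ) - p.2 + w = 0
  · obtain ⟨p, hp, hpw⟩ := h
    have hpn := mem_antidiagonal.1 hp
    obtain ⟨a, l, hal⟩ : ∃ a l : ℕ, ∀ s : ℂ, 0 < s.re →
        hermiteMellin p.1 p.2 s = Complex.Gamma (s + a / 2) * mellinPoly a l s := by
      rcases le_total p.2 p.1 with hle | hle
      · refine ⟨p.1 - p.2, p.2, fun s hs => ?_⟩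
        rw [← hermiteMellin_eq_Gamma_mul _ _ hs]
        congr 1
        omega
      · refine ⟨p.2 - p.1, p.1, fun s hs => ?_⟩
        rw [← hermiteMellin_eq_Gamma_mul _ _ hs, hermiteMellin_comm]
        congr 1
        omega
    refine ⟨b p * Real.pi, t, a, l, fun s hs => ?_⟩
    rw [hsum s hs, Finset.sum_eq_single p, if_pos hpw, hal _ (by rwa [hre])]
    · ring
    · intro q hq hqp
      rw [if_neg, mul_zero, mul_zero]
      intro hqw
      have hqn := mem_antidiagonal.1 hq
      apply hqp
      ext <;> omega
    · exact fun h => absurd hp h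
  · push Not at h
    refine ⟨0, t, 0, 0, fun s hs => ?_⟩
    rw [hsum s hs, zero_mul, zero_mul, zero_mul]
    refine Finset.sum_eq_zero fun p hp => ?_
    rw [if_neg (h p hp), mul_zero, mul_zero]

/-! ### Meromorphic continuation -/

/-- The identity theorem: the difference has infinite order at `1`, and infinite order propagates
over the connected plane. -/
theorem meromorphic_eventuallyEq_of_eqOn_re_pos {f g : ℂ → ℂ} (hf : MeromorphicOn f Set.univ)
    (hg : MeromorphicOn g Set.univ) (h : ∀ s : ℂ, 0 < s.re → f s = g s) (x : ℂ) :
    f =ᶠ[nhdsWithin x {x}ᶜ] g := by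
  have hsub := hf.sub hg
  have h1 : meromorphicOrderAt (f - g) 1 = ⊤ := by
    rw [meromorphicOrderAt_eq_top_iff]
    apply Filter.Eventually.filter_mono nhdsWithin_le_nhds
    filter_upwards [(isOpen_lt continuous_const Complex.continuous_re).mem_nhds
      (show (0 : ℝ) < (1 : ℂ).re by simp)] with s hs
    rw [Pi.sub_apply, h s hs, sub_self]
  have hx : meromorphicOrderAt (f - g) x = ⊤ := by
    by_contra hne
    exact hsub.meromorphicOrderAt_ne_top_of_isPreconnected isPreconnected_univ
      (Set.mem_univ x) (Set.mem_univ 1) hne h1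
  rw [meromorphicOrderAt_eq_top_iff] at hx
  filter_upwards [hx] with s hs
  exact sub_eq_zero.1 hs

theorem IsTateZeta.unique {ν : ℂˣ →ₜ* Circle} {f : 𝓢(ℂ, ℂ)} {Z₁ Z₂ : ℂ → ℂ}
    (h₁ : IsTateZeta ν f Z₁) (h₂ : IsTateZeta ν f Z₂) : Z₁ = Z₂ := by
  ext x
  have h := meromorphic_eventuallyEq_of_eqOn_re_pos h₁.meromorphic.meromorphicOn
    h₂.meromorphic.meromorphicOn
    (fun s hs => (h₁.eq_integral s hs).trans (h₂.eq_integral s hs).symm) x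
  exact (((h₁.meromorphic (Set.mem_univ x)).eventuallyEq_nhdsNE_iff_eventuallyEq_nhds
    (h₂.meromorphic (Set.mem_univ x))).1 h).eq_of_nhds

end

end WeilSU2

/-! ### Assembly: continuation and location of the zeros -/

open WeilSU2 in
theorem theorem1 (c : ℂ) (hc : c ≠ 0) (V : Submodule ℂ (SchwartzMap ℂ ℂ))
    (hV : IsIrreducibleWeilSubspace c V) (f : SchwartzMap ℂ ℂ) (hf : f ∈ V)
    (ν : ℂˣ →ₜ* Circle) :
    (∀ s : ℂ, 0 < s.re →
      MeasureTheory.IntegrableOn (tateIntegrand ν f s) ({0}ᶜ : Set ℂ)) ∧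
    (∃! Z : ℂ → ℂ, IsTateZeta ν f Z) ∧
    (∀ Z : ℂ → ℂ, IsTateZeta ν f Z → (∃ s : ℂ, Z s ≠ 0) →
      ∀ s : ℂ, AnalyticAt ℂ Z s → Z s = 0 → s.re = 1 / 2) := by
  have hA : 0 < Real.pi * ‖c‖ := mul_pos Real.pi_pos (norm_pos_iff.2 hc)
  have hA' : ((Real.pi * ‖c‖ : ℝ) : ℂ) ≠ 0 := by exact_mod_cast hA.ne'
  obtain ⟨n, b, hb⟩ := exists_hermite_expansion hc hV hf
  obtain ⟨C, t, a, l, hint⟩ := exists_integral_tateIntegrand_eq hA hb ν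
  have hre : ∀ s : ℂ, (s + Complex.I * t / 2).re = s.re := by
    intro s
    have : Complex.I * t / 2 = ((t / 2 : ℝ) : ℂ) * Complex.I := by push_cast; ring
    rw [this]
    simp
  have hre' : ∀ s : ℂ, 0 < s.re → 0 < (s + Complex.I * t / 2 + a / 2).re := by
    intro s hs
    have h1 : ((a : ℂ) / 2).re = a / 2 := by simp
    rw [Complex.add_re, hre, h1]
    positivity
  set g : ℂ → ℂ := fun s => C * ((Real.pi * ‖c‖ : ℝ) : ℂ) ^ (-(s + Complex.I * t / 2 + n / 2))
          * mellinPoly a l (s + Complex.I * t / 2) with hg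
  have hgd : Differentiable ℂ g := by
    have h1 := differentiable_mellinPoly a l
    have h2 : Differentiable ℂ fun s : ℂ =>
        ((Real.pi * ‖c‖ : ℝ) : ℂ) ^ (-(s + Complex.I * t / 2 + n / 2)) := fun s =>
      DifferentiableAt.const_cpow (by fun_prop) (Or.inl hA')
    exact (h2.const_mul C).mul (h1.comp (by fun_prop))
  have hgm : MeromorphicOn g Set.univ := fun s _ => (hgd.analyticAt s).meromorphicAt
  set Γ : ℂ → ℂ := fun s => Complex.Gamma (s + Complex.I * t / 2 + a / 2) with hΓ
  have hΓm : MeromorphicOn Γ Set.univ := fun s _ =>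
    (Meromorphic.Gamma (s + Complex.I * t / 2 + a / 2)).comp_analyticAt
      (f := Complex.Gamma) (g := fun s : ℂ => s + Complex.I * t / 2 + a / 2) (by fun_prop)
  have hEm : MeromorphicOn (fun s => g s * Γ s) Set.univ := hgm.mul hΓm
  have hEa : ∀ s : ℂ, 0 < s.re → AnalyticAt ℂ (fun s => g s * Γ s) s := by
    intro s hs
    have hopen : IsOpen {s : ℂ | 0 < s.re} := isOpen_lt continuous_const Complex.continuous_re
    refine DifferentiableOn.analyticAt (s := {s : ℂ | 0 < s.re}) (fun x hx => ?_)
      (hopen.mem_nhds hs)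
    have hx' := hre' x hx
    have h1 : DifferentiableAt ℂ Complex.Gamma (x + Complex.I * t / 2 + a / 2) := by
      refine Complex.differentiableAt_Gamma _ fun m hm => ?_
      rw [hm] at hx'
      simp at hx'
      linarith [(Nat.cast_nonneg m : (0 : ℝ) ≤ m)]
    have h2 : DifferentiableAt ℂ Γ x := h1.comp x (by fun_prop)
    exact ((hgd x).mul h2).differentiableWithinAt
  refine ⟨fun s hs => integrableOn_tateIntegrand hA hb ν hs, ?_, ?_⟩
  · refine ⟨toMeromorphicNFOn (fun s => g s * Γ s) Set.univ,
      ⟨meromorphicNFOn_toMeromorphicNFOn _ _, fun s hs => ?_⟩, fun Z hZ => hZ.unique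
        ⟨meromorphicNFOn_toMeromorphicNFOn _ _, fun s hs => ?_⟩⟩ <;>
    · rw [toMeromorphicNFOn_eq_toMeromorphicNFAt hEm (Set.mem_univ s),
        toMeromorphicNFAt_eq_self.2 (hEa s hs).meromorphicNFAt, hint s hs]
  · intro Z hZ ⟨s₀, hs₀⟩ s hZa hZs
    -- If `C = 0`, the zero function is a continuation, and uniqueness makes `Z` vanish identically.
    have hC : C ≠ 0 := by
      rintro rfl
      have h0 : IsTateZeta ν f fun _ => 0 :=
        ⟨fun x _ => analyticAt_const.meromorphicNFAt, fun s hs => by rw [hint s hs]; simp⟩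
      exact hs₀ (congrFun (hZ.unique h0) s₀)
    have hinv : Differentiable ℂ fun s => (Γ s)⁻¹ :=
      Complex.differentiable_one_div_Gamma.comp (by fun_prop)
    -- Multiplying by the entire function `1/Γ` avoids dividing at the poles of `Γ`: a zero of `Z`
    -- at a point of analyticity gives a zero of the entire function `g`, even where `Γ` has a pole.
    have heq := meromorphic_eventuallyEq_of_eqOn_re_pos
      (f := fun s => Z s * (Γ s)⁻¹) (g := g)
      (hZ.meromorphic.meromorphicOn.mul fun s _ => (hinv.analyticAt s).meromorphicAt) hgm
      (fun s hs => by
        have hne : Γ s ≠ 0 := Complex.Gamma_ne_zero_of_re_pos (hre' s hs)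
        rw [hZ.eq_integral s hs, hint s hs, mul_inv_cancel_right₀ hne]) s
    have hlim1 : Filter.Tendsto (fun s => Z s * (Γ s)⁻¹) (nhdsWithin s {s}ᶜ) (nhds 0) := by
      have := (hZa.continuousAt.mul hinv.continuous.continuousAt).tendsto.mono_left
        (nhdsWithin_le_nhds (s := {s}ᶜ))
      rw [Pi.mul_apply, hZs, zero_mul] at this
      exact this
    have hlim2 : Filter.Tendsto g (nhdsWithin s {s}ᶜ) (nhds (g s)) :=
      hgd.continuous.continuousAt.tendsto.mono_left nhdsWithin_le_nhds
    have hgs : g s = 0 := tendsto_nhds_unique (hlim2.congr' heq.symm) hlim1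
    rw [hg] at hgs
    have hcp : ((Real.pi * ‖c‖ : ℝ) : ℂ) ^ (-(s + Complex.I * t / 2 + n / 2)) ≠ 0 := by
      rw [Ne, Complex.cpow_eq_zero_iff]
      exact fun h => hA' h.1
    have hQ := (mul_eq_zero.1 hgs).resolve_left (mul_ne_zero hC hcp)
    rw [← hre s]
    exact re_eq_half_of_mellinPoly_eq_zero hQ
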